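/- Let $d\ge 1$, let $\beta\ge 0$, and let $\phi:\mathbb R^d\to\mathbb R\cup\{\infty\}$ be a Borel measurable function with $\phi(-x)=\phi(x)\in\mathbb R$ for all $x\ne 0$. Assume: (RP) there are $R_1>0$ and a decreasing continuous function $\Phi:(0,\infty)\to[0,\infty)$ with $\lim_{t\to 0}\Phi(t)t^d=\infty$ such that $\phi(x)\ge\Phi(|x|)$ for $0<|x|\le R_1$; moreover $\phi$ is bounded from above on $\{x: r\le|x|\le R_1\}$ for every $r>0$; (T) there are $A<\infty$, $0<R_2<\infty$ and $\lambda>d$ such that $|\phi(x)|\le A|x|^{-\lambda}$ for $|x|\ge R_2$; (BB) there is $B\ge 0$ such that $\phi(x)\ge -B$ for all $x\in\mathbb R^d$. Let $(\Lambda_N)_{N\in\mathbb N}$ be bounded Borel subsets of $\mathbb R^d$ with Lebesgue measure $|\Lambda_N|>0$ which exhaust $\mathbb R^d$ (every bounded set is contained in $\Lambda_N$ for all large $N$), and suppose that $N/|\Lambda_N|\to\rho\in(0,\infty)$. For bounded Borel $\Lambda$ with $|\Lambda|>0$ and $N\in\mathbb N$ put $$E_\phi(z_1,\dots,z_m)=\sum_{1\le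 i<j\le m}\phi(z_i-z_j),\qquad Z^{(N)}_\Lambda=\int_{\Lambda^N}e^{-\beta E_\phi(z_1,\dots,z_N)}\,dz_1\cdots dz_N,$$ with the conventions $e^{-\infty}=0$ and $0\cdot\infty=0$. The $n$-th correlation function of the canonical $N$-particle Gibbs measure in $\Lambda$ with empty boundary condition and inverse temperature $\beta$ is, for $1\le n\le N$, $$k^{(n,N)}_\Lambda(x_1,\dots,x_n)=\frac{N(N-1)\cdots(N-n+1)}{Z^{(N)}_\Lambda}\int_{\Lambda^{N-n}}e^{-\beta E_\phi(x_1,\dots,x_n,y_1,\dots,y_{N-n})}\,dy_1\cdots dy_{N-n},$$ with $k^{(0,N)}_\Lambda=1$ and $k^{(n,N)}_\Lambda=0$ for $n>N$. Then for all sufficiently large $N_0\in\mathbb N$ the following holds. There is a constant $\xi<\infty$ such that $$k^{(n,N)}_{\Lambda_N}(x_1,\dots,x_n)\le\xi^n\qquad\text{for all } N\ge N_0,\ n\in\mathbb N,\ (x_1,\dots,x_n)\in(\Lambda_N)^n,$$ and there is a constant $\zeta<\infty$ such that $$k^{(n,N)}_{\Lambda_N}(x_1,\dots,x_n)\le\exp\Big(-\frac2n\sum_{1\le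 i<j\le n}\beta\,\phi(x_i-x_j)\Big)\zeta^n\qquad\text{for all } N\ge N_0,\ n\ge 2,\ (x_1,\dots,x_n)\in(\Lambda_N)^n.$$ If $\phi(0)=\infty$, both bounds hold for all tuples, coincident points included; if $\phi(0)$ is finite, they are asserted for tuples of pairwise distinct points. -/

import Mathlib

open MeasureTheory Filter Topology
open scoped NNReal ENNReal

noncomputable section

namespace CanonicalGibbs

/-- The Euclidean space `ℝ^d`; its `volume` is Lebesgue measure. -/
abbrev Space (d : ℕ) : Type := EuclideanSpace ℝ (Fin d)

/-- A pair potential without hard core: a Borel measurable function `φ : ℝ^d → ℝ ∪ {∞}` with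
`φ (-x) = φ x ∈ ℝ` for all `x ≠ 0`. -/
structure IsPairPotential {d : ℕ} (φ : Space d → EReal) : Prop where
  measurable : Measurable φ
  even : ∀ x, φ (-x) = φ x
  ne_top : ∀ x, x ≠ 0 → φ x ≠ ⊤
  ne_bot : ∀ x, φ x ≠ ⊥

/-- (RP), repulsion. -/
def Repulsive {d : ℕ} (φ : Space d → EReal) : Prop :=
  ∃ (Φ : ℝ → ℝ) (R₁ : ℝ), 0 < R₁ ∧
    (∀ t, 0 < t → 0 ≤ Φ t) ∧
    AntitoneOn Φ (Set.Ioi 0) ∧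
    ContinuousOn Φ (Set.Ioi 0) ∧
    Tendsto (fun t : ℝ => Φ t * t ^ d) (𝓝[>] 0) atTop ∧
    (∀ x : Space d, 0 < ‖x‖ → ‖x‖ ≤ R₁ → ((Φ ‖x‖ : ℝ) : EReal) ≤ φ x) ∧
    (∀ r : ℝ, 0 < r → ∃ M : ℝ, ∀ x : Space d, r ≤ ‖x‖ → ‖x‖ ≤ R₁ → φ x ≤ (M : EReal))

/-- (T), temperedness: `|φ x| ≤ A |x|^(-lam)` for `|x| ≥ R₂`, for some `lam > d`. -/
def Tempered {d : ℕ} (φ : Space d → EReal) : Prop :=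
  ∃ A R₂ lam : ℝ, 0 < R₂ ∧ (d : ℝ) < lam ∧
    ∀ x : Space d, R₂ ≤ ‖x‖ →
      ((-(A * ‖x‖ ^ (-lam)) : ℝ) : EReal) ≤ φ x ∧ φ x ≤ ((A * ‖x‖ ^ (-lam) : ℝ) : EReal)

/-- (BB), boundedness from below. -/
def BddBelowBy {d : ℕ} (φ : Space d → EReal) : Prop :=
  ∃ B : ℝ, 0 ≤ B ∧ ∀ x : Space d, ((-B : ℝ) : EReal) ≤ φ x

/-- The potential energy, with empty boundary condition, of the particles `z 0, …, z (m - 1)`: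
the sum of `φ (z i - z j)` over the pairs `i < j`. -/
def energy {d : ℕ} (φ : Space d → EReal) {m : ℕ} (z : Fin m → Space d) : EReal :=
  ∑ p : Fin m × Fin m with p.1 < p.2, φ (z p.1 - z p.2)

/-- The Boltzmann factor `exp (-β E(z))`, with values in `[0, ∞]`. -/
def boltzmann {d : ℕ} (φ : Space d → EReal) (β : ℝ) {m : ℕ} (z : Fin m → Space d) : ℝ≥0∞ :=
  EReal.exp (-((β : EReal) * energy φ z))

/-- The power `Λ^m`, as a set of `m`-tuples. -/
def power {d : ℕ} (Λ : Set (Space d)) (m : ℕ) : Set (Fin m → Space d) :=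
  {y | ∀ i, y i ∈ Λ}

/-- The canonical partition function of `N` particles in `Λ`. The reference measure on the
`N`-point configurations in `Λ` is the image of Lebesgue measure on `Λ^N` under
`(x₁, …, x_N) ↦ {x₁, …, x_N}` (no factor `1 / N!`), so that this is an integral over `Λ^N`. -/
def partitionFunction {d : ℕ} (φ : Space d → EReal) (β : ℝ) (Λ : Set (Space d)) (N : ℕ) : ℝ≥0∞ :=
  ∫⁻ z in power Λ N, boltzmann φ β z

/-- The `n`-th order correlation function of the canonical `N`-particle Gibbs measure
`Z⁻¹ exp (-β E)` in `Λ` with empty boundary condition. -/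
def correlation {d : ℕ} (φ : Space d → EReal) (β : ℝ) (Λ : Set (Space d)) (n N : ℕ)
    (x : Fin n → Space d) : ℝ≥0∞ :=
  if n = 0 then 1
  else if N < n then 0
  else (N.descFactorial n : ℝ≥0∞) / partitionFunction φ β Λ N *
    ∫⁻ y in power Λ (N - n), boltzmann φ β (Fin.append x y)

/-- `Λ` is a sequence of volumes corresponding to the density `ρ > 0`: bounded Borel sets of
positive Lebesgue measure, exhausting `ℝ^d`, with `N / |Λ_N| → ρ`. -/
structure IsVolumeSequence {d : ℕ} (Λ : ℕ → Set (Space d)) (ρ : ℝ) : Prop where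
  bounded : ∀ N, Bornology.IsBounded (Λ N)
  measurable : ∀ N, MeasurableSet (Λ N)
  pos : ∀ N, 0 < volume (Λ N)
  exhausts : ∀ K : Set (Space d), Bornology.IsBounded K → ∃ N₁, ∀ N, N₁ ≤ N → K ⊆ Λ N
  density_pos : 0 < ρ
  tendsto : Tendsto (fun N : ℕ => (N : ℝ) / (volume (Λ N)).toReal) atTop (𝓝 ρ)

end CanonicalGibbs

end

noncomputable section

namespace CanonicalGibbs

/-! Cut space into small cubes. By (RP), two particles in the same cube repel with energy at least
`G`. By (T) and (BB), all pairs attract by at most a kernel `b` whose row sums are bounded by some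
`C`. Since the row sums grow only like `r ^ (-d)` while `Φ t * t ^ d → ∞`, a small enough cube side
gives `12 * C ≤ G`.

Fix `x` and a configuration `y` of the other particles. Call a cube overfull if it holds more than
`h` of the `y`-particles, where the threshold `h` grows like a small power of the distance to the
points `x i`. Let `S` be the particles in overfull cubes. Deleting `x` and `S` removes energy at
least `G / 8 * ∑ l ∈ S, h (cy l)` minus a constant times `n` (`removal_energy_ge`): self-repulsion
beats attraction, and the remaining cubes hold too few particles to attract strongly.

Summing over all candidates `S` and integrating, each deleted particle of `S` costs `∫ exp (-(G / 8)
h)`. Because `h` grows away from `x`, this is at most `k * n`, uniformly in the volume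
(`exists_lintegral_threshold_le`). What remains is a partition function with `n + m` fewer
particles, `m` being the size of `S`. A particle can be inserted into a substantial fraction of `Λ`
at bounded energy cost (`exists_insertion_bound`), so each missing particle is restored at the price
of a factor of order `1 / |Λ|`. At bounded density these factors absorb `N ^ (n + m)`, and the sum
over `m` is an exponential series of size `exp (const * n)` (`descFactorial_mul_sum_le`).

For the improved bound, keep the exact Boltzmann factors of all pairs through one index `i`. These
are at most `n` pairs, so giving up their repulsion costs at most `G * n` in the energy estimate.
Averaging over `i` yields an index whose pairs carry at least `2 / n` of the total energy. -/

theorem sum_lt_eq_half {ι : Type*} [Fintype ι] [LinearOrder ι] (f : ι → ι → ℝ)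
    (hf : ∀ i j, f i j = f j i) :
    ∑ p : ι × ι with p.1 < p.2, f p.1 p.2 = ((∑ i, ∑ j, f i j) - ∑ i, f i i) / 2 := by
  have h1 : ∑ i, ∑ j, f i j = ∑ p : ι × ι, f p.1 p.2 := (Fintype.sum_prod_type' _).symm
  have h2 : ∑ i, f i i = ∑ p : ι × ι with p.1 = p.2, f p.1 p.2 := by
    rw [Finset.sum_filter, Fintype.sum_prod_type]
    simp
  have h3 : ∑ p : ι × ι with p.2 < p.1, f p.1 p.2 = ∑ p : ι × ι with p.1 < p.2, f p.1 p.2 := by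
    refine Finset.sum_nbij' Prod.swap Prod.swap ?_ ?_ ?_ ?_ ?_ <;> simp [hf]
  have h4 : ∑ p : ι × ι, f p.1 p.2 = ∑ p : ι × ι with p.1 < p.2, f p.1 p.2 +
      (∑ p : ι × ι with p.1 = p.2, f p.1 p.2 + ∑ p : ι × ι with p.2 < p.1, f p.1 p.2) := by
    simp only [Finset.sum_filter, ← Finset.sum_add_distrib]
    refine Finset.sum_congr rfl fun p _ => ?_
    rcases lt_trichotomy p.1 p.2 with h | h | h
    · simp [h, h.ne, h.le]
    · simp [h]
    · simp [h, h.ne', h.le]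
  rw [h1, h2, h4, h3]
  ring

/-! ### Energy estimates for particles in cells. -/

section Cells

variable {κ : Type*} [DecidableEq κ]

/-- Schur test for the occupation numbers `m a`: use `2 * m a * m j ≤ m a ^ 2 + m j ^ 2`, the
symmetry of `b` and its row sums. The right-hand side is `C * ∑ m a ^ 2`, written as a sum over
particles. -/
theorem sum_kernel_le {P : Type*} [Fintype P] (k : P → κ) (b : κ → κ → ℝ) (C : ℝ)
    (hb : ∀ a j, 0 ≤ b a j) (hs : ∀ a j, b a j = b j a)
    (hC : ∀ (F : Finset κ) (a : κ), ∑ j ∈ F, b a j ≤ C) :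
    ∑ p, ∑ q, b (k p) (k q) ≤ C * ∑ p, ((Finset.univ.filter fun q => k q = k p).card : ℝ) := by
  classical
  set F := Finset.univ.image k
  set m : κ → ℝ := fun a => ((Finset.univ.filter fun q => k q = a).card : ℝ)
  have key : ∀ f : κ → ℝ, ∑ p, f (k p) = ∑ a ∈ F, m a * f a := fun f => by
    rw [Finset.sum_comp f k]
    simp [m, F]
  have e1 : ∑ p, ∑ q, b (k p) (k q) = ∑ a ∈ F, ∑ j ∈ F, m a * m j * b a j := by
    rw [key fun a => ∑ q, b a (k q)]
    refine Finset.sum_congr rfl fun a _ => ?_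
    rw [key fun j => b a j, Finset.mul_sum]
    exact Finset.sum_congr rfl fun j _ => by ring
  have e2 : ∑ p, ((Finset.univ.filter fun q => k q = k p).card : ℝ) = ∑ a ∈ F, m a * m a :=
    key m
  have e3 : ∑ a ∈ F, ∑ j ∈ F, m a * m j * b a j ≤
      ∑ a ∈ F, ∑ j ∈ F, (m a ^ 2 * b a j / 2 + m j ^ 2 * b a j / 2) := by
    refine Finset.sum_le_sum fun a _ => Finset.sum_le_sum fun j _ => ?_
    nlinarith [mul_nonneg (sq_nonneg (m a - m j)) (hb a j)]
  have e4 : ∑ a ∈ F, ∑ j ∈ F, m j ^ 2 * b a j / 2 = ∑ a ∈ F, ∑ j ∈ F, m a ^ 2 * b a j / 2 := by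
    rw [Finset.sum_comm]
    exact Finset.sum_congr rfl fun j _ => Finset.sum_congr rfl fun a _ => by rw [hs]
  have e5 : ∑ a ∈ F, ∑ j ∈ F, m a ^ 2 * b a j / 2 ≤ ∑ a ∈ F, C * (m a * m a) / 2 := by
    refine Finset.sum_le_sum fun a _ => ?_
    rw [← Finset.sum_div, ← Finset.mul_sum]
    nlinarith [mul_le_mul_of_nonneg_left (hC F a) (sq_nonneg (m a))]
  have e6 : ∑ a ∈ F, C * (m a * m a) / 2 = C * (∑ a ∈ F, m a * m a) / 2 := by
    rw [Finset.mul_sum, Finset.sum_div]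
  simp only [Finset.sum_add_distrib] at e3
  rw [e1, e2]
  linarith

theorem sum_kernel_le_of_card_le {M : ℕ} (cy : Fin M → κ) (R : Finset (Fin M))
    (b : κ → ℝ) (h : κ → ℝ) (K : ℝ) (hb : ∀ j, 0 ≤ b j)
    (hR : ∀ l ∈ R, ((Finset.univ.filter fun l' => cy l' = cy l).card : ℝ) ≤ h (cy l))
    (hK : ∀ F : Finset κ, ∑ j ∈ F, b j * h j ≤ K) :
    ∑ l ∈ R, b (cy l) ≤ K := by
  classical
  rw [Finset.sum_comp b cy]
  refine (Finset.sum_le_sum fun j hj => ?_).trans (hK (R.image cy))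
  obtain ⟨l, hl, rfl⟩ := Finset.mem_image.1 hj
  rw [nsmul_eq_mul, mul_comm]
  refine mul_le_mul_of_nonneg_left (le_trans ?_ (hR l hl)) (hb _)
  exact_mod_cast Finset.card_le_card
    (Finset.filter_subset_filter _ (Finset.subset_univ R))

/-- The interaction of two particles in cells `a` and `j`: repulsion `G` inside a cell, attraction
at most `b a j`. -/
def cellEnergy (G : ℝ) (b : κ → κ → ℝ) (a j : κ) : ℝ := (if a = j then G else 0) - b a j

/-- The interaction of the `l`-th and the `l'`-th particle, of which those in `S` are to be
removed and those outside `S` do not interact among themselves. -/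
def removalEnergy {M : ℕ} (cy : Fin M → κ) (S : Finset (Fin M)) (G : ℝ) (b : κ → κ → ℝ)
    (l l' : Fin M) : ℝ :=
  if l ∈ S then (if l' ∈ S then cellEnergy G b (cy l) (cy l') else -b (cy l) (cy l'))
  else (if l' ∈ S then -b (cy l) (cy l') else 0)

/-- Within `x` and `S`, same-cell repulsion is quadratic in the occupation numbers and dominates
attraction by the Schur test. Attraction to the particles outside `S` is controlled by `hCh`, since
their cells respect the threshold. -/
theorem removal_energy_ge {n M : ℕ} (cx : Fin n → κ) (cy : Fin M → κ) (b : κ → κ → ℝ) (h : κ → ℝ)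
    (G C H : ℝ) (hC0 : 0 ≤ C) (hb : ∀ a j, 0 ≤ b a j) (hs : ∀ a j, b a j = b j a)
    (hC : ∀ (F : Finset κ) (a : κ), ∑ j ∈ F, b a j ≤ C)
    (hCh : ∀ (F : Finset κ) (a : κ), ∑ j ∈ F, b a j * h j ≤ C * h a)
    (h1 : ∀ a, 1 ≤ h a) (hH : ∀ i, h (cx i) ≤ H) (hG : 12 * C ≤ G) (S : Finset (Fin M))
    (hS : ∀ l, l ∈ S ↔ h (cy l) < ((Finset.univ.filter fun l' => cy l' = cy l).card : ℝ)) :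
    G / 8 * ∑ l ∈ S, h (cy l) - (C / 2 + C * H) * n ≤
      ∑ p : Fin n × Fin n with p.1 < p.2, cellEnergy G b (cx p.1) (cx p.2) +
      ∑ i, ∑ l, (if l ∈ S then cellEnergy G b (cx i) (cy l) else -b (cx i) (cy l)) +
      ∑ p : Fin M × Fin M with p.1 < p.2, removalEnergy cy S G b p.1 p.2 := by
  classical
  have hes : ∀ a j, cellEnergy G b a j = cellEnergy G b j a := fun a j => by
    unfold cellEnergy
    rw [hs a j]
    by_cases hh : a = j
    · simp [hh]
    · simp [hh, Ne.symm hh]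
  rw [sum_lt_eq_half (fun i j => cellEnergy G b (cx i) (cx j)) fun i j => hes _ _,
    sum_lt_eq_half (removalEnergy cy S G b) fun i j => by
      unfold removalEnergy
      rw [hes, hs (cy i)]
      split_ifs <;> rfl]
  -- The points of `x` and the particles of `S` are treated as a single system, with `m p` the
  -- occupation number of the cell of `p`.
  set k : Fin n ⊕ S → κ := Sum.elim cx fun l => cy l
  set R : Finset (Fin M) := Sᶜ
  set m : Fin n ⊕ S → ℝ := fun p => ((Finset.univ.filter fun q => k q = k p).card : ℝ)
  -- interactions among the removed particles
  have hPP : ∑ p, ∑ q, cellEnergy G b (k p) (k q) =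
      (∑ i, ∑ j, cellEnergy G b (cx i) (cx j)) +
      2 * (∑ i, ∑ l ∈ S, cellEnergy G b (cx i) (cy l)) +
      ∑ l ∈ S, ∑ l' ∈ S, cellEnergy G b (cy l) (cy l') := by
    simp only [Fintype.sum_sum_type, k, Sum.elim_inl, Sum.elim_inr, Finset.sum_add_distrib]
    have t1 : ∀ f : Fin M → ℝ, ∑ l : S, f l = ∑ l ∈ S, f l := fun f => Finset.sum_coe_sort S f
    have t2 : ∑ l : S, ∑ i, cellEnergy G b (cy l) (cx i) =
        ∑ i, ∑ l ∈ S, cellEnergy G b (cx i) (cy l) := by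
      rw [t1 fun l => ∑ i, cellEnergy G b (cy l) (cx i), Finset.sum_comm]
      exact Finset.sum_congr rfl fun i _ => Finset.sum_congr rfl fun l _ => hes _ _
    have t3 : ∑ l : S, ∑ l' : S, cellEnergy G b (cy l) (cy l') =
        ∑ l ∈ S, ∑ l' ∈ S, cellEnergy G b (cy l) (cy l') := by
      rw [t1 fun l => ∑ l' : S, cellEnergy G b (cy l) (cy l')]
      exact Finset.sum_congr rfl fun l _ => t1 fun l' => cellEnergy G b (cy l) (cy l')
    have t4 : ∑ i, ∑ l : S, cellEnergy G b (cx i) (cy l) =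
        ∑ i, ∑ l ∈ S, cellEnergy G b (cx i) (cy l) :=
      Finset.sum_congr rfl fun i _ => t1 fun l => cellEnergy G b (cx i) (cy l)
    rw [t2, t3, t4]
    ring
  have hPP' : (G - C) * ∑ p, m p ≤ ∑ p, ∑ q, cellEnergy G b (k p) (k q) := by
    have := sum_kernel_le k b C hb hs hC
    have e : ∑ p, ∑ q, (if k p = k q then G else 0) = G * ∑ p, m p := by
      rw [Finset.mul_sum]
      refine Finset.sum_congr rfl fun p _ => ?_
      rw [← Finset.sum_filter, Finset.sum_const, nsmul_eq_mul, mul_comm]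
      simp only [m, eq_comm]
    simp only [cellEnergy, Finset.sum_sub_distrib, e]
    linarith
  have hcross : ∀ a, ∑ l ∈ R, b a (cy l) ≤ C * h a := fun a => by
    refine sum_kernel_le_of_card_le cy R (b a) h (C * h a) (hb a) (fun l hl => ?_)
      fun F => hCh F a
    simpa [R, hS] using hl
  have hsplit : ∀ f : Fin M → ℝ, ∑ l, f l = ∑ l ∈ S, f l + ∑ l ∈ R, f l := fun f =>
    (Finset.sum_add_sum_compl S f).symm
  have hR : ∀ l ∈ R, l ∉ S := fun l hl => by simpa [R] using hl
  have hXY : ∑ i, ∑ l, (if l ∈ S then cellEnergy G b (cx i) (cy l) else -b (cx i) (cy l)) =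
      (∑ i, ∑ l ∈ S, cellEnergy G b (cx i) (cy l)) - ∑ i, ∑ l ∈ R, b (cx i) (cy l) := by
    rw [← Finset.sum_sub_distrib]
    refine Finset.sum_congr rfl fun i _ => ?_
    rw [hsplit, sub_eq_add_neg, ← Finset.sum_neg_distrib]
    refine congrArg₂ _ (Finset.sum_congr rfl fun l hl => by simp [hl])
      (Finset.sum_congr rfl fun l hl => by simp [hR l hl])
  have hYY : ∑ l, ∑ l', removalEnergy cy S G b l l' =
      (∑ l ∈ S, ∑ l' ∈ S, cellEnergy G b (cy l) (cy l')) -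
        2 * ∑ l ∈ S, ∑ l' ∈ R, b (cy l) (cy l') := by
    rw [hsplit]
    have t1 : ∑ l ∈ S, ∑ l', removalEnergy cy S G b l l' =
        (∑ l ∈ S, ∑ l' ∈ S, cellEnergy G b (cy l) (cy l')) -
          ∑ l ∈ S, ∑ l' ∈ R, b (cy l) (cy l') := by
      rw [← Finset.sum_sub_distrib]
      refine Finset.sum_congr rfl fun l hl => ?_
      rw [hsplit, sub_eq_add_neg, ← Finset.sum_neg_distrib]
      refine congrArg₂ _ (Finset.sum_congr rfl fun l' hl' => by simp [removalEnergy, hl, hl'])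
        (Finset.sum_congr rfl fun l' hl' => by simp [removalEnergy, hl, hR l' hl'])
    have t2 : ∑ l ∈ R, ∑ l', removalEnergy cy S G b l l' =
        - ∑ l ∈ S, ∑ l' ∈ R, b (cy l) (cy l') := by
      rw [Finset.sum_comm (s := S), ← Finset.sum_neg_distrib]
      refine Finset.sum_congr rfl fun l hl => ?_
      rw [hsplit, ← Finset.sum_neg_distrib]
      rw [Finset.sum_congr rfl fun l' hl' => show removalEnergy cy S G b l l' = -b (cy l') (cy l) by
        simp [removalEnergy, hR l hl, hl', hs (cy l)]]
      rw [Finset.sum_eq_zero (s := R) fun l' hl' => by simp [removalEnergy, hR l hl, hR l' hl']]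
      simp
    rw [t1, t2]
    ring
  have hXX0 : ∑ i, cellEnergy G b (cx i) (cx i) ≤ G * n := by
    calc ∑ i, cellEnergy G b (cx i) (cx i) ≤ ∑ _i : Fin n, G :=
          Finset.sum_le_sum fun i _ => by simp [cellEnergy, hb]
      _ = G * n := by simp [mul_comm]
  have hYY0 : ∑ l, removalEnergy cy S G b l l ≤ ∑ l ∈ S, G := by
    rw [hsplit, Finset.sum_eq_zero (s := R) fun l' hl' => by simp [removalEnergy, hR l' hl'],
      add_zero]
    exact Finset.sum_le_sum fun l hl => by simp [removalEnergy, cellEnergy, hl, hb]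
  have hm : ∑ p, m p = ∑ i, m (Sum.inl i) + ∑ l : S, m (Sum.inr l) := Fintype.sum_sum_type _
  have hmx : ∀ i, 1 ≤ m (Sum.inl i) := fun i => by
    have : 0 < (Finset.univ.filter fun q => k q = k (Sum.inl i)).card :=
      Finset.card_pos.2 ⟨Sum.inl i, by simp⟩
    exact Nat.one_le_cast.2 this
  have hmy : ∀ l : S, h (cy l) ≤ m (Sum.inr l) ∧ 2 ≤ m (Sum.inr l) := fun l => by
    have hl := (hS l).1 l.2
    have hle : (Finset.univ.filter fun l' => cy l' = cy l).card ≤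
        (Finset.univ.filter fun q => k q = k (Sum.inr l)).card := by
      -- Membership in `S` depends only on the cell, so `S` contains every particle of each overfull
      -- cell. The count exceeds `h ≥ 1`, and being an integer it is at least `2`.
      have hmem : ∀ l', cy l' = cy l → l' ∈ S := fun l' hl' => (hS l').2 (by rw [hl']; exact hl)
      refine Finset.card_le_card_of_injOn
        (fun l' => if hl' : l' ∈ S then Sum.inr ⟨l', hl'⟩ else Sum.inr l) ?_ ?_
      · intro l' hl'
        have hl'' : cy l' = cy l := by simpa using hl'
        beta_reduce
        rw [dif_pos (hmem l' hl'')]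
        exact Finset.mem_coe.2 (Finset.mem_filter.2 ⟨Finset.mem_univ _, hl''⟩)
      · intro l₁ h₁ l₂ h₂ heq
        have h₁' : cy l₁ = cy l := by simpa using h₁
        have h₂' : cy l₂ = cy l := by simpa using h₂
        simpa [hmem _ h₁', hmem _ h₂'] using heq
    have hle' : ((Finset.univ.filter fun l' => cy l' = cy l).card : ℝ) ≤ m (Sum.inr l) :=
      Nat.cast_le.2 hle
    have h2 : (1 : ℝ) < ((Finset.univ.filter fun l' => cy l' = cy l).card : ℝ) :=
      (h1 _).trans_lt hl
    have h2' : 2 ≤ (Finset.univ.filter fun l' => cy l' = cy l).card := by exact_mod_cast h2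
    have h2'' : (2 : ℝ) ≤ ((Finset.univ.filter fun l' => cy l' = cy l).card : ℝ) := by
      exact_mod_cast h2'
    exact ⟨hl.le.trans hle', h2''.trans hle'⟩
  have hx1 : ∑ i, ∑ l ∈ R, b (cx i) (cy l) ≤ ∑ i : Fin n, C * H :=
    Finset.sum_le_sum fun i _ => (hcross _).trans (mul_le_mul_of_nonneg_left (hH i) hC0)
  have hy1 : ∑ l ∈ S, ∑ l' ∈ R, b (cy l) (cy l') ≤ ∑ l : S, C * h (cy l) := by
    rw [Finset.sum_coe_sort S fun l => C * h (cy l)]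
    exact Finset.sum_le_sum fun l _ => hcross _
  have hxs : -(C / 2 + C * H) * n ≤
      ∑ i, ((G - C) / 2 * m (Sum.inl i)) - G / 2 * n - ∑ i : Fin n, C * H := by
    have : ∑ i : Fin n, (G - C) / 2 ≤ ∑ i, ((G - C) / 2 * m (Sum.inl i)) :=
      Finset.sum_le_sum fun i _ => le_mul_of_one_le_right (by linarith) (hmx i)
    simp only [Finset.sum_const, Finset.card_univ, Fintype.card_fin, nsmul_eq_mul] at this ⊢
    linarith
  -- Per particle: `m ≥ 2` bounds the self term `G / 2` by `G / 4 * m`, and `h ≤ m` bounds both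
  -- attractions by `3 / 2 * C * m ≤ G / 8 * m`. This leaves `G / 8 * m ≥ G / 8 * h`, which is where
  -- the factor `12` is used.
  have hys : G / 8 * ∑ l ∈ S, h (cy l) ≤
      ∑ l : S, ((G - C) / 2 * m (Sum.inr l)) - (∑ l ∈ S, G) / 2 - ∑ l : S, C * h (cy l) := by
    rw [← Finset.sum_coe_sort S fun l => h (cy l), ← Finset.sum_coe_sort S fun _ => G,
      Finset.mul_sum, Finset.sum_div, ← Finset.sum_sub_distrib, ← Finset.sum_sub_distrib]
    refine Finset.sum_le_sum fun l _ => ?_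
    obtain ⟨hl1, hl2⟩ := hmy l
    have hg : 0 ≤ G := by linarith
    have a1 := mul_le_mul_of_nonneg_left hl1 hC0
    have a2 := mul_le_mul_of_nonneg_left hl1 hg
    have a3 := mul_le_mul_of_nonneg_left hl2 hg
    have a4 := mul_le_mul_of_nonneg_right hG (show 0 ≤ m (Sum.inr l) by linarith)
    linarith
  rw [hm, mul_add] at hPP'
  simp only [← Finset.mul_sum] at hxs hys hx1 hy1
  rw [hXY, hYY]
  linarith

end Cells

/-! ### Products of pair weights and their integrals. -/

section Weights

variable {E : Type*}

/-- The product of the weights `W (z i) (z j)` over the pairs `i < j`. -/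
def pairWeight (W : E → E → ℝ≥0∞) {ι : Type*} [Fintype ι] [LinearOrder ι] (z : ι → E) : ℝ≥0∞ :=
  ∏ p : ι × ι with p.1 < p.2, W (z p.1) (z p.2)

theorem pairWeight_eq_prod_ite (W : E → E → ℝ≥0∞) {ι : Type*} [Fintype ι] [LinearOrder ι]
    (z : ι → E) : pairWeight W z = ∏ i, ∏ j, if i < j then W (z i) (z j) else 1 := by
  rw [pairWeight, Finset.prod_filter, Fintype.prod_prod_type]

theorem pairWeight_append (W : E → E → ℝ≥0∞) {n M : ℕ} (x : Fin n → E) (y : Fin M → E) :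
    pairWeight W (Fin.append x y) =
      pairWeight W x * (∏ i, ∏ l, W (x i) (y l)) * pairWeight W y := by
  have h1 : ∀ (i : Fin n) (l : Fin M), Fin.castAdd M i < Fin.natAdd n l := fun i l => by
    rw [Fin.lt_def, Fin.val_castAdd, Fin.val_natAdd]; omega
  have h2 : ∀ (i : Fin n) (l : Fin M), ¬ Fin.natAdd n l < Fin.castAdd M i := fun i l =>
    (h1 i l).not_gt
  have h3 : ∀ i j : Fin n, Fin.castAdd M i < Fin.castAdd M j ↔ i < j := fun i j => Iff.rfl
  have h4 : ∀ i j : Fin M, Fin.natAdd n i < Fin.natAdd n j ↔ i < j := fun i j => by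
    rw [Fin.lt_def, Fin.lt_def, Fin.val_natAdd, Fin.val_natAdd]; omega
  simp only [pairWeight_eq_prod_ite, Fin.prod_univ_add, Fin.append_left, Fin.append_right, h1, h2,
    h3, h4, if_true, if_false, Finset.prod_mul_distrib, Finset.prod_const_one, mul_one, mul_assoc]

theorem pairWeight_cons (W : E → E → ℝ≥0∞) {M : ℕ} (u : E) (y : Fin M → E) :
    pairWeight W (Fin.cons u y : Fin (M + 1) → E) = (∏ l, W u (y l)) * pairWeight W y := by
  simp only [pairWeight_eq_prod_ite, Fin.prod_univ_succ, Fin.cons_zero, Fin.cons_succ,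
    Fin.succ_lt_succ_iff, Fin.succ_pos, if_true, if_false, one_mul,
    Fin.not_lt_zero]

theorem pairWeight_comp_orderIso (W : E → E → ℝ≥0∞) {ι ι' : Type*} [Fintype ι] [LinearOrder ι]
    [Fintype ι'] [LinearOrder ι'] (e : ι ≃o ι') (z : ι → E) :
    pairWeight W (z ∘ e.symm) = pairWeight W z := by
  simp only [pairWeight_eq_prod_ite]
  refine Fintype.prod_equiv e.symm.toEquiv _ _ fun i => ?_
  refine Fintype.prod_equiv e.symm.toEquiv _ _ fun j => ?_
  simp

/-- The part of `pairWeight W y` that comes from the pairs outside `S`. -/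
def pairWeightOff (W : E → E → ℝ≥0∞) {M : ℕ} (S : Finset (Fin M)) (y : Fin M → E) : ℝ≥0∞ :=
  pairWeight W fun l : {l // l ∉ S} => y l

theorem pairWeightOff_eq (W : E → E → ℝ≥0∞) {M : ℕ} (S : Finset (Fin M)) (y : Fin M → E) :
    pairWeightOff W S y = ∏ p : Fin M × Fin M with p.1 < p.2,
      if p.1 ∉ S ∧ p.2 ∉ S then W (y p.1) (y p.2) else 1 := by
  classical
  rw [pairWeightOff, pairWeight_eq_prod_ite, Finset.prod_filter, Fintype.prod_prod_type]
  have key : ∀ f : Fin M → ℝ≥0∞, ∏ l : {l // l ∉ S}, f l = ∏ l, if l ∉ S then f l else 1 :=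
    fun f => by
      rw [← Finset.prod_filter]
      exact (Finset.prod_subtype _ (by simp) f).symm
  have h1 : ∀ i : {l // l ∉ S}, (∏ j : {l // l ∉ S}, if i < j then W (y i) (y j) else 1) =
      (fun l : Fin M => ∏ j, if j ∉ S then (if l < j then W (y l) (y j) else 1) else 1) i :=
    fun i => key fun j => if (i : Fin M) < j then W (y i) (y j) else 1
  rw [Finset.prod_congr rfl fun i _ => h1 i]
  refine (key fun l => ∏ j, if j ∉ S then (if l < j then W (y l) (y j) else 1) else 1).trans ?_
  refine Finset.prod_congr rfl fun i _ => ?_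
  by_cases hi : i ∈ S
  · simp [hi]
  · simp only [hi, not_false_eq_true, if_true, true_and]
    refine Finset.prod_congr rfl fun j _ => ?_
    split_ifs <;> rfl

variable [MeasurableSpace E]

theorem measurable_pairWeight {W : E → E → ℝ≥0∞} (hW : Measurable (Function.uncurry W))
    {ι : Type*} [Fintype ι] [LinearOrder ι] :
    Measurable fun z : ι → E => pairWeight W z :=
  Finset.measurable_prod _ fun p _ =>
    show Measurable (Function.uncurry W ∘ fun z : ι → E => (z p.1, z p.2)) from hW.comp ((measurable_pi_apply p.1).prodMk (measurable_pi_apply p.2))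

variable (μ : Measure E)

/-- The partition function of `M` particles with reference measure `μ`. -/
def partitionIntegral (W : E → E → ℝ≥0∞) (M : ℕ) : ℝ≥0∞ :=
  ∫⁻ z, pairWeight W z ∂Measure.pi (fun _ : Fin M => μ)

variable [SigmaFinite μ]

theorem lintegral_pi_reindex {ι ι' : Type*} [Fintype ι] [Fintype ι'] (e : ι ≃ ι')
    (F : (ι → E) → ℝ≥0∞) :
    ∫⁻ z, F z ∂Measure.pi (fun _ : ι => μ) =
      ∫⁻ z, F (z ∘ e) ∂Measure.pi (fun _ : ι' => μ) := by
  have h := measurePreserving_piCongrLeft (fun _ : ι' => μ) e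
  rw [← h.lintegral_comp_emb (MeasurableEquiv.measurableEmbedding _)]
  refine lintegral_congr fun z => congrArg F (funext fun i => ?_)
  exact (MeasurableEquiv.piCongrLeft_apply_apply e (β := fun _ => E) z i).symm

theorem lintegral_pi_succ (M : ℕ) {F : (Fin (M + 1) → E) → ℝ≥0∞} (hF : Measurable F) :
    ∫⁻ z, F z ∂Measure.pi (fun _ : Fin (M + 1) => μ) =
      ∫⁻ y, ∫⁻ u, F (Fin.cons u y) ∂μ ∂Measure.pi (fun _ : Fin M => μ) := by
  have h := (measurePreserving_piFinSuccAbove (fun _ : Fin (M + 1) => μ) 0).symm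
  rw [← h.lintegral_comp_emb (MeasurableEquiv.measurableEmbedding _), lintegral_prod_symm]
  · refine lintegral_congr fun y => lintegral_congr fun u => congrArg F ?_
    simp [MeasurableEquiv.piFinSuccAbove]
    rfl
  · exact (hF.comp (MeasurableEquiv.measurable _)).aemeasurable

theorem lintegral_pi_prod {ι : Type*} [Fintype ι] {g : E → ℝ≥0∞} (hg : Measurable g) :
    ∫⁻ z, ∏ i, g (z i) ∂Measure.pi (fun _ : ι => μ) = (∫⁻ u, g u ∂μ) ^ Fintype.card ι := by
  rw [lintegral_pi_reindex μ (Fintype.equivFin ι)]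
  simp only [Function.comp_apply]
  have : ∀ z : Fin (Fintype.card ι) → E,
      ∏ i, g (z (Fintype.equivFin ι i)) = ∏ i, g (z i) := fun z =>
    (Fintype.equivFin ι).prod_comp fun i => g (z i)
  simp only [this]
  generalize Fintype.card ι = k
  induction k with
  | zero => simp
  | succ k ih =>
    rw [lintegral_pi_succ μ k (by fun_prop)]
    simp only [Fin.prod_univ_succ, Fin.cons_zero, Fin.cons_succ]
    have : ∀ y : Fin k → E, ∫⁻ u, g u * ∏ i, g (y i) ∂μ = (∫⁻ u, g u ∂μ) * ∏ i, g (y i) :=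
      fun y => lintegral_mul_const _ hg
    simp only [this]
    rw [lintegral_const_mul _ (by fun_prop), ih, pow_succ']

theorem lintegral_pairWeight_eq {W : E → E → ℝ≥0∞} {ι : Type*} [Fintype ι] [LinearOrder ι] {k : ℕ}
    (hk : Fintype.card ι = k) :
    ∫⁻ z, pairWeight W z ∂Measure.pi (fun _ : ι => μ) = partitionIntegral μ W k := by
  let e := Fintype.orderIsoFinOfCardEq ι hk
  rw [lintegral_pi_reindex μ e.symm.toEquiv]
  exact lintegral_congr fun z => pairWeight_comp_orderIso W e z

/-- By Tonelli, the coordinates in `S` decouple from the others, which form a smaller system of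
their own. -/
theorem lintegral_prod_mul_pairWeightOff {W : E → E → ℝ≥0∞}
    (hW : Measurable (Function.uncurry W)) {g : E → ℝ≥0∞} (hg : Measurable g) {M : ℕ}
    (S : Finset (Fin M)) :
    ∫⁻ y, (∏ l ∈ S, g (y l)) * pairWeightOff W S y ∂Measure.pi (fun _ : Fin M => μ) =
      (∫⁻ u, g u ∂μ) ^ S.card * partitionIntegral μ W (M - S.card) := by
  classical
  have h := measurePreserving_piEquivPiSubtypeProd (fun _ : Fin M => μ) (· ∈ S)
  have e : ∀ y : Fin M → E, (∏ l ∈ S, g (y l)) * pairWeightOff W S y =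
      (fun q : ({l // l ∈ S} → E) × ({l // l ∉ S} → E) =>
        (∏ l, g (q.1 l)) * pairWeight W q.2)
        (MeasurableEquiv.piEquivPiSubtypeProd (fun _ : Fin M => E) (· ∈ S) y) := fun y => by
    simp only [pairWeightOff]
    refine congrArg₂ _ ?_ rfl
    exact (Finset.prod_coe_sort S fun l => g (y l)).symm
  rw [lintegral_congr e]
  refine (h.lintegral_comp_emb (MeasurableEquiv.measurableEmbedding _)
    fun q : ({l // l ∈ S} → E) × ({l // l ∉ S} → E) =>
      (∏ l, g (q.1 l)) * pairWeight W q.2).trans ?_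
  rw [lintegral_prod_mul (f := fun a : {l // l ∈ S} → E => ∏ l, g (a l))
      (g := fun a : {l // l ∉ S} → E => pairWeight W a)]
  · refine congrArg₂ (· * ·) ?_ ?_
    · have := lintegral_pi_prod (ι := {l // l ∈ S}) μ hg
      rw [Fintype.card_coe] at this
      convert this
    · have hk : Fintype.card {l // l ∉ S} = M - S.card := by
        rw [Fintype.card_subtype_compl]; simp
      convert lintegral_pairWeight_eq μ (W := W) hk
  · exact Measurable.aemeasurable (by fun_prop)
  · exact (measurable_pairWeight hW).aemeasurable

/-- Integrate out the added particle first; `c` bounds its integral below uniformly in the others.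
-/
theorem mul_partitionIntegral_le {W : E → E → ℝ≥0∞} (hW : Measurable (Function.uncurry W)) {M : ℕ}
    {c : ℝ≥0∞} (hc : ∀ y : Fin M → E, c ≤ ∫⁻ u, ∏ l, W u (y l) ∂μ) :
    c * partitionIntegral μ W M ≤ partitionIntegral μ W (M + 1) := by
  rw [partitionIntegral, partitionIntegral, lintegral_pi_succ μ M (measurable_pairWeight hW),
    ← lintegral_const_mul _ (measurable_pairWeight hW)]
  refine lintegral_mono fun y => ?_
  simp only [pairWeight_cons]
  rw [lintegral_mul_const]
  · gcongr
    exact hc y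
  · exact Finset.measurable_prod _ fun l _ => hW.comp (measurable_id.prodMk measurable_const)

theorem pow_mul_partitionIntegral_le {W : E → E → ℝ≥0∞} (hW : Measurable (Function.uncurry W))
    {N : ℕ} {c : ℝ≥0∞}
    (hc : ∀ M ≤ N, ∀ y : Fin M → E, c ≤ ∫⁻ u, ∏ l, W u (y l) ∂μ) (j M : ℕ) (hj : M + j ≤ N) :
    c ^ j * partitionIntegral μ W M ≤ partitionIntegral μ W (M + j) := by
  induction j with
  | zero => simp
  | succ j ih =>
    rw [pow_succ', mul_assoc]
    refine (mul_le_mul_right (ih (by omega)) c).trans ?_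
    exact mul_partitionIntegral_le μ hW (hc _ (by omega))

end Weights

/-! ### Removal of overfull cells and the combinatorial sum. -/

section Removal

variable {E κ : Type*} [DecidableEq κ]

theorem prod_le_ofReal_exp {ι : Type*} (s : Finset ι) (f : ι → ℝ≥0∞) (e : ι → ℝ)
    (h : ∀ i ∈ s, f i ≤ ENNReal.ofReal (Real.exp (-e i))) :
    ∏ i ∈ s, f i ≤ ENNReal.ofReal (Real.exp (-∑ i ∈ s, e i)) := by
  refine (Finset.prod_le_prod' h).trans ?_
  rw [← ENNReal.ofReal_prod_of_nonneg fun i _ => (Real.exp_pos _).le, ← Real.exp_sum,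
    Finset.sum_neg_distrib]

/-- The exponential form of `removal_energy_ge`. The set `D` is reserved for pairs of `x` whose
exact weights are kept outside the estimate. -/
theorem weight_le_sum_removal {n M : ℕ} {W : E → E → ℝ≥0∞} (c : E → κ) (b : κ → κ → ℝ) (h : κ → ℝ)
    (G C H : ℝ) (hC0 : 0 ≤ C) (hb : ∀ a j, 0 ≤ b a j) (hs : ∀ a j, b a j = b j a)
    (hC : ∀ (F : Finset κ) (a : κ), ∑ j ∈ F, b a j ≤ C)
    (hCh : ∀ (F : Finset κ) (a : κ), ∑ j ∈ F, b a j * h j ≤ C * h a)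
    (h1 : ∀ a, 1 ≤ h a) (hG : 12 * C ≤ G)
    (hW : ∀ u v, W u v ≤ ENNReal.ofReal (Real.exp (-cellEnergy G b (c u) (c v))))
    (x : Fin n → E) (hH : ∀ i, h (c (x i)) ≤ H) (D : Finset (Fin n × Fin n))
    (hD : D ⊆ Finset.univ.filter fun p => p.1 < p.2) (hDn : D.card ≤ n) (y : Fin M → E) :
    (∏ p ∈ (Finset.univ.filter fun p : Fin n × Fin n => p.1 < p.2) \ D, W (x p.1) (x p.2)) *
        (∏ i, ∏ l, W (x i) (y l)) * pairWeight W y ≤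
      ENNReal.ofReal (Real.exp ((C / 2 + C * H + G) * n)) *
        ∑ S : Finset (Fin M),
          (∏ l ∈ S, ENNReal.ofReal (Real.exp (-(G / 8 * h (c (y l)))))) * pairWeightOff W S y := by
  classical
  have hG0 : 0 ≤ G := by linarith
  have hW' : ∀ u v, W u v ≤ ENNReal.ofReal (Real.exp (-(-b (c u) (c v)))) := fun u v => by
    refine (hW u v).trans (ENNReal.ofReal_le_ofReal (Real.exp_le_exp.2 ?_))
    unfold cellEnergy
    split_ifs <;> linarith
  let S : Finset (Fin M) := Finset.univ.filter fun l => h (c (y l)) <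
    ((Finset.univ.filter fun l' => c (y l') = c (y l)).card : ℝ)
  have hS : ∀ l, l ∈ S ↔ h (c (y l)) <
    ((Finset.univ.filter fun l' => c (y l') = c (y l)).card : ℝ) := fun l => by simp [S]
  have key := removal_energy_ge (fun i => c (x i)) (fun l => c (y l)) b h G C H hC0 hb hs hC hCh
    h1 hH hG S hS
  have b1 := prod_le_ofReal_exp ((Finset.univ.filter fun p : Fin n × Fin n => p.1 < p.2) \ D)
    (fun p => W (x p.1) (x p.2)) (fun p => cellEnergy G b (c (x p.1)) (c (x p.2)))
    fun p _ => hW _ _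
  have b2 : ∏ i, ∏ l, W (x i) (y l) ≤ ENNReal.ofReal (Real.exp (-∑ i, ∑ l,
      (if l ∈ S then cellEnergy G b (c (x i)) (c (y l)) else -b (c (x i)) (c (y l))))) := by
    refine prod_le_ofReal_exp _ _ _ fun i _ => prod_le_ofReal_exp _ _ _ fun l _ => ?_
    split_ifs
    · exact hW _ _
    · exact hW' _ _
  have b3 : pairWeight W y ≤ pairWeightOff W S y * ENNReal.ofReal (Real.exp
      (-∑ p : Fin M × Fin M with p.1 < p.2, removalEnergy (fun l => c (y l)) S G b p.1 p.2)) := by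
    rw [← Finset.sum_neg_distrib, Real.exp_sum,
      ENNReal.ofReal_prod_of_nonneg fun i _ => (Real.exp_pos _).le, pairWeightOff_eq,
      ← Finset.prod_mul_distrib]
    refine Finset.prod_le_prod' fun p _ => ?_
    unfold removalEnergy
    by_cases h1 : p.1 ∈ S <;> by_cases h2 : p.2 ∈ S
    · simpa [h1, h2] using hW (y p.1) (y p.2)
    · simpa [h1, h2] using hW' (y p.1) (y p.2)
    · simpa [h1, h2] using hW' (y p.1) (y p.2)
    · simp [h1, h2]
  -- A pair has cell energy at most `G`, so leaving out the at most `n` pairs of `D` costs at most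
  -- `G * n`.
  have hDsum : ∑ p : Fin n × Fin n with p.1 < p.2, cellEnergy G b (c (x p.1)) (c (x p.2)) ≤
      ∑ p ∈ (Finset.univ.filter fun p : Fin n × Fin n => p.1 < p.2) \ D,
        cellEnergy G b (c (x p.1)) (c (x p.2)) + G * n := by
    rw [← Finset.sum_sdiff hD]
    gcongr
    calc ∑ p ∈ D, cellEnergy G b (c (x p.1)) (c (x p.2)) ≤ ∑ _p ∈ D, G :=
          Finset.sum_le_sum fun p _ => by
            have := hb (c (x p.1)) (c (x p.2))
            unfold cellEnergy
            split_ifs <;> linarith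
      _ = G * D.card := by simp [mul_comm]
      _ ≤ G * n := by gcongr
  have b4 : ∏ l ∈ S, ENNReal.ofReal (Real.exp (-(G / 8 * h (c (y l))))) =
      ENNReal.ofReal (Real.exp (-(G / 8 * ∑ l ∈ S, h (c (y l))))) := by
    rw [← ENNReal.ofReal_prod_of_nonneg fun i _ => (Real.exp_pos _).le, ← Real.exp_sum,
      Finset.sum_neg_distrib, Finset.mul_sum]
  refine (mul_le_mul' (mul_le_mul' b1 b2) b3).trans ?_
  -- The set `S` depends on `y`. Bounding its term by the sum over all subsets removes this
  -- dependence, so each term can be integrated separately.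
  refine le_trans ?_ (mul_le_mul_right (Finset.single_le_sum (f := fun S : Finset (Fin M) =>
    (∏ l ∈ S, ENNReal.ofReal (Real.exp (-(G / 8 * h (c (y l)))))) * pairWeightOff W S y)
    (fun _ _ => zero_le) (Finset.mem_univ S)) _)
  have comm : ∀ A B P R : ℝ≥0∞, A * B * (P * R) = A * B * R * P := fun A B P R => by ring
  rw [b4, comm, ← mul_assoc]
  refine mul_le_mul_left ?_ _
  simp only [← ENNReal.ofReal_mul (Real.exp_pos _).le, ← Real.exp_add]
  exact ENNReal.ofReal_le_ofReal (Real.exp_le_exp.2 (by linarith))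

theorem descFactorial_mul_choose_le (N n m : ℕ) :
    N.descFactorial n * (N - n).choose m * m.factorial ≤ N ^ (n + m) := by
  have h := Nat.descFactorial_mul_descFactorial (n := N) (Nat.le_add_right n m)
  rw [Nat.add_sub_cancel_left, Nat.descFactorial_eq_factorial_mul_choose] at h
  calc N.descFactorial n * (N - n).choose m * m.factorial = N.descFactorial (n + m) := by
        rw [← h]; ring
    _ ≤ N ^ (n + m) := Nat.descFactorial_le_pow _ _

theorem sum_pow_div_factorial_le (t : ℝ≥0) (k : ℕ) :
    ∑ m ∈ Finset.range k, (t : ℝ≥0∞) ^ m / (m.factorial : ℝ≥0∞) ≤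
      ENNReal.ofReal (Real.exp t) := by
  refine le_trans (le_of_eq ?_) (ENNReal.ofReal_le_ofReal
    (Real.sum_le_exp_of_nonneg t.coe_nonneg k))
  rw [ENNReal.ofReal_sum_of_nonneg fun i _ => by positivity]
  refine Finset.sum_congr rfl fun m _ => ?_
  rw [ENNReal.ofReal_div_of_pos (by positivity), ENNReal.ofReal_pow t.coe_nonneg,
    ENNReal.ofReal_coe_nnreal, ENNReal.ofReal_natCast]

variable [MeasurableSpace E] (μ : Measure E) [SigmaFinite μ]

/-- Group the subsets by size `m`. The counting factor is at most `N ^ (n + m) / m!`, hence at most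
`(a * v) ^ (n + m) / m!`, and `v ^ (n + m)` pays for reinserting `n + m` particles. What is left is
a partial exponential series in `a * k * n`. -/
theorem descFactorial_mul_sum_le {W : E → E → ℝ≥0∞} (hW : Measurable (Function.uncurry W))
    {N n : ℕ} (hn : n ≤ N) {v : ℝ≥0∞} {a k : ℝ≥0} (hv : (N : ℝ≥0∞) ≤ a * v)
    (hc : ∀ M ≤ N, ∀ y : Fin M → E, v ≤ ∫⁻ u, ∏ l, W u (y l) ∂μ) {K : ℝ≥0∞}
    (hK : K ≤ k * n) :
    (N.descFactorial n : ℝ≥0∞) * ∑ S : Finset (Fin (N - n)),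
        K ^ S.card * partitionIntegral μ W (N - n - S.card) ≤
      (a * ENNReal.ofReal (Real.exp (a * k))) ^ n * partitionIntegral μ W N := by
  rw [← Finset.powerset_univ, Finset.sum_powerset_apply_card
    (fun m => K ^ m * partitionIntegral μ W (N - n - m)), Finset.card_univ, Fintype.card_fin,
    Finset.mul_sum]
  have step : ∀ m ∈ Finset.range (N - n + 1),
      (N.descFactorial n : ℝ≥0∞) * ((N - n).choose m •
        (K ^ m * partitionIntegral μ W (N - n - m))) ≤
      (a : ℝ≥0∞) ^ n * partitionIntegral μ W N *
        (((a * k * n : ℝ≥0) : ℝ≥0∞) ^ m / (m.factorial : ℝ≥0∞)) := fun m hm => by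
    have hm' : m ≤ N - n := by simpa [Nat.lt_succ_iff] using hm
    have hZ := pow_mul_partitionIntegral_le μ hW hc (n + m) (N - n - m) (by omega)
    rw [show N - n - m + (n + m) = N by omega] at hZ
    have hd : (N.descFactorial n : ℝ≥0∞) * ((N - n).choose m : ℝ≥0∞) * (m.factorial : ℝ≥0∞) ≤
        (a * v) ^ (n + m) := by
      refine le_trans ?_ (pow_le_pow_left' hv (n + m))
      exact_mod_cast descFactorial_mul_choose_le N n m
    rw [← mul_div_assoc, ENNReal.le_div_iff_mul_le (Or.inl (by positivity))
      (Or.inl (ENNReal.natCast_ne_top _)), nsmul_eq_mul]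
    calc (N.descFactorial n : ℝ≥0∞) * (((N - n).choose m : ℝ≥0∞) *
          (K ^ m * partitionIntegral μ W (N - n - m))) * (m.factorial : ℝ≥0∞)
        = ((N.descFactorial n : ℝ≥0∞) * ((N - n).choose m : ℝ≥0∞) * (m.factorial : ℝ≥0∞)) *
          K ^ m * partitionIntegral μ W (N - n - m) := by ring
      _ ≤ (a * v) ^ (n + m) * (k * n) ^ m * partitionIntegral μ W (N - n - m) := by gcongr
      _ = a ^ (n + m) * (k * n) ^ m * (v ^ (n + m) * partitionIntegral μ W (N - n - m)) := by
        ring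
      _ ≤ a ^ (n + m) * (k * n) ^ m * partitionIntegral μ W N := by gcongr
      _ = _ := by push_cast; ring
  refine (Finset.sum_le_sum step).trans ?_
  rw [← Finset.mul_sum, mul_pow]
  refine (mul_le_mul_right (sum_pow_div_factorial_le _ _) _).trans (le_of_eq ?_)
  rw [← ENNReal.ofReal_pow (Real.exp_pos _).le, ← Real.exp_nat_mul, mul_right_comm]
  push_cast
  ring_nf

theorem descFactorial_mul_lintegral_le {W : E → E → ℝ≥0∞} (hWm : Measurable (Function.uncurry W))
    (c : E → κ) (b : κ → κ → ℝ) (h : κ → ℝ)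
    (G C H : ℝ) (hC0 : 0 ≤ C) (hb : ∀ a j, 0 ≤ b a j) (hs : ∀ a j, b a j = b j a)
    (hC : ∀ (F : Finset κ) (a : κ), ∑ j ∈ F, b a j ≤ C)
    (hCh : ∀ (F : Finset κ) (a : κ), ∑ j ∈ F, b a j * h j ≤ C * h a)
    (h1 : ∀ a, 1 ≤ h a) (hG : 12 * C ≤ G)
    (hW : ∀ u v, W u v ≤ ENNReal.ofReal (Real.exp (-cellEnergy G b (c u) (c v))))
    {N n : ℕ} (hn : n ≤ N) (x : Fin n → E) (hH : ∀ i, h (c (x i)) ≤ H)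
    (D : Finset (Fin n × Fin n)) (hD : D ⊆ Finset.univ.filter fun p => p.1 < p.2)
    (hDn : D.card ≤ n) {v : ℝ≥0∞} {a k : ℝ≥0} (hv : (N : ℝ≥0∞) ≤ a * v)
    (hc : ∀ M ≤ N, ∀ y : Fin M → E, v ≤ ∫⁻ u, ∏ l, W u (y l) ∂μ)
    (hm : Measurable fun u => h (c u))
    (hK : ∫⁻ u, ENNReal.ofReal (Real.exp (-(G / 8 * h (c u)))) ∂μ ≤ k * n) :
    (N.descFactorial n : ℝ≥0∞) * ∫⁻ y, (∏ p ∈ (Finset.univ.filter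
          fun p : Fin n × Fin n => p.1 < p.2) \ D, W (x p.1) (x p.2)) *
        (∏ i, ∏ l, W (x i) (y l)) * pairWeight W y ∂Measure.pi (fun _ : Fin (N - n) => μ) ≤
      (ENNReal.ofReal (Real.exp (C / 2 + C * H + G)) *
        (a * ENNReal.ofReal (Real.exp (a * k)))) ^ n * partitionIntegral μ W N := by
  have hgm : Measurable fun u => ENNReal.ofReal (Real.exp (-(G / 8 * h (c u)))) :=
    (Real.measurable_exp.comp (hm.const_mul (G / 8)).neg).ennreal_ofReal
  have hoff : ∀ S : Finset (Fin (N - n)), Measurable fun y : Fin (N - n) → E =>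
      (∏ l ∈ S, ENNReal.ofReal (Real.exp (-(G / 8 * h (c (y l)))))) * pairWeightOff W S y :=
    fun S => by
      refine Measurable.mul (Finset.measurable_prod _ fun l _ =>
        hgm.comp (measurable_pi_apply l)) ?_
      exact (measurable_pairWeight hWm).comp
        (measurable_pi_lambda _ fun l => measurable_pi_apply _)
  have hint := lintegral_mono (μ := Measure.pi (fun _ : Fin (N - n) => μ)) fun y =>
    weight_le_sum_removal c b h G C H hC0 hb hs hC hCh h1 hG hW x hH D hD hDn y
  rw [lintegral_const_mul _ (Finset.measurable_sum _ fun S _ => hoff S),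
    lintegral_finsetSum _ fun S _ => hoff S,
    Finset.sum_congr rfl fun S _ => lintegral_prod_mul_pairWeightOff μ hWm hgm S] at hint
  refine (mul_le_mul_right hint _).trans ?_
  rw [mul_left_comm, mul_pow, mul_assoc, ← ENNReal.ofReal_pow (Real.exp_pos _).le,
    ← Real.exp_nat_mul, mul_comm (n : ℝ)]
  exact mul_le_mul_right (descFactorial_mul_sum_le μ hWm hn hv hc hK) _

end Removal

/-! ### Inserting one particle at bounded cost. -/

section Insertion

variable {d : ℕ}

theorem exists_decay_bound {R lam K : ℝ} (hR : 0 < R) (hlam : 0 ≤ lam) (hK : 0 ≤ K) (A : ℝ) :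
    ∃ C : ℝ, 0 ≤ C ∧ (∀ s, 0 ≤ s → s < R → K ≤ C * (1 + s) ^ (-lam)) ∧
      ∀ s, R ≤ s → A * s ^ (-lam) ≤ C * (1 + s) ^ (-lam) := by
  refine ⟨max (K * (1 + R) ^ lam) (|A| * ((1 + R) / R) ^ lam),
    le_max_of_le_left (by positivity), fun s hs hsR => ?_, fun s hs => ?_⟩
  · calc K = K * (1 + R) ^ lam * (1 + R) ^ (-lam) := by
          rw [mul_assoc, ← Real.rpow_add (by positivity)]; simp
      _ ≤ K * (1 + R) ^ lam * (1 + s) ^ (-lam) := by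
          refine mul_le_mul_of_nonneg_left ?_ (by positivity)
          exact Real.rpow_le_rpow_of_nonpos (by positivity) (by linarith) (by linarith)
      _ ≤ _ := by
          gcongr
          exact le_max_left _ _
  · have hs0 : 0 < s := hR.trans_le hs
    have hkey : s ^ (-lam) ≤ ((1 + R) / R) ^ lam * (1 + s) ^ (-lam) := by
      rw [Real.rpow_neg hs0.le, Real.rpow_neg (by positivity), ← div_eq_mul_inv,
        ← Real.div_rpow (by positivity) (by positivity), ← Real.inv_rpow hs0.le]
      refine Real.rpow_le_rpow (by positivity) ?_ hlam
      rw [div_div, inv_eq_one_div, div_le_div_iff₀ hs0 (by positivity)]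
      nlinarith
    calc A * s ^ (-lam) ≤ |A| * s ^ (-lam) := by
          gcongr
          exact le_abs_self A
      _ ≤ |A| * (((1 + R) / R) ^ lam * (1 + s) ^ (-lam)) := by gcongr
      _ = |A| * ((1 + R) / R) ^ lam * (1 + s) ^ (-lam) := by ring
      _ ≤ _ := by
          gcongr
          exact le_max_right _ _

/-- The sets where `w < exp (-K)` inside the ball of radius `R` decrease to a null set as `K → ∞`,
so some `K` gives a set of measure at most `ε`. Outside the ball the decay hypothesis applies. -/
theorem exists_lower_bound_off_small_set {w : Space d → ℝ≥0∞} (hw : Measurable w)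
    (h0 : ∀ᵐ v, w v ≠ 0) {A R lam : ℝ} (hR : 0 < R) (hlam : 0 ≤ lam)
    (hA : ∀ v : Space d, R ≤ ‖v‖ → ENNReal.ofReal (Real.exp (-(A * ‖v‖ ^ (-lam)))) ≤ w v)
    {ε : ℝ≥0∞} (hε : ε ≠ 0) :
    ∃ (A' : ℝ) (D : Set (Space d)), 0 ≤ A' ∧ MeasurableSet D ∧ volume D ≤ ε ∧
      ∀ v ∉ D, ENNReal.ofReal (Real.exp (-(A' * (1 + ‖v‖) ^ (-lam)))) ≤ w v := by
  let D : ℕ → Set (Space d) := fun K =>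
    Metric.ball 0 R ∩ {v | w v < ENNReal.ofReal (Real.exp (-(K : ℝ)))}
  have hDm : ∀ K, MeasurableSet (D K) := fun K =>
    Metric.isOpen_ball.measurableSet.inter (measurableSet_lt hw measurable_const)
  have hanti : Antitone D := fun K K' hKK' v hv => by
    refine ⟨hv.1, lt_of_lt_of_le hv.2 (ENNReal.ofReal_le_ofReal (Real.exp_le_exp.2 ?_))⟩
    exact neg_le_neg (by exact_mod_cast hKK')
  have hnull : volume (⋂ K, D K) = 0 := by
    refine measure_mono_null (fun v hv => ?_) (ae_iff.1 h0)
    simp only [Set.mem_iInter] at hv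
    simp only [Set.mem_ofPred_eq, not_not]
    have hlim : Tendsto (fun K : ℕ => ENNReal.ofReal (Real.exp (-(K : ℝ)))) atTop (𝓝 0) := by
      rw [← ENNReal.ofReal_zero]
      exact ENNReal.tendsto_ofReal
        (Real.tendsto_exp_neg_atTop_nhds_zero.comp tendsto_natCast_atTop_atTop)
    exact le_antisymm (ge_of_tendsto' hlim fun K => (hv K).2.le) zero_le
  have hlim := tendsto_measure_iInter_atTop (μ := (volume : Measure (Space d)))
    (fun K => (hDm K).nullMeasurableSet) hanti
    ⟨0, ((measure_mono Set.inter_subset_left).trans_lt measure_ball_lt_top).ne⟩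
  rw [hnull] at hlim
  obtain ⟨K, hK⟩ := (hlim.eventually (gt_mem_nhds (pos_iff_ne_zero.2 hε))).exists
  obtain ⟨C, hC, hC₁, hC₂⟩ := exists_decay_bound hR hlam (Nat.cast_nonneg K) A
  refine ⟨C, D K, hC, hDm K, hK.le, fun v hv => ?_⟩
  by_cases hvR : ‖v‖ < R
  · have hv' : ENNReal.ofReal (Real.exp (-(K : ℝ))) ≤ w v := by
      by_contra hc
      exact hv ⟨by simpa using hvR, not_le.1 hc⟩
    exact le_trans (ENNReal.ofReal_le_ofReal (Real.exp_le_exp.2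
      (neg_le_neg (hC₁ _ (norm_nonneg v) hvR)))) hv'
  · exact le_trans (ENNReal.ofReal_le_ofReal (Real.exp_le_exp.2
      (neg_le_neg (hC₂ _ (not_lt.1 hvR))))) (hA v (not_lt.1 hvR))

/-- Two kinds of positions are bad: those too close to some `y l`, and those where the summed tails
are large. Together they fill at most three quarters of `Λ`; elsewhere the product is at least `exp
(-t)`. -/
theorem exists_insertion_bound {w : Space d → ℝ≥0∞} (hw : Measurable w)
    (h0 : ∀ᵐ v, w v ≠ 0) {A R lam : ℝ} (hR : 0 < R) (hlam : (d : ℝ) < lam)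
    (hA : ∀ v : Space d, R ≤ ‖v‖ → ENNReal.ofReal (Real.exp (-(A * ‖v‖ ^ (-lam)))) ≤ w v)
    {ρ : ℝ≥0} (hρ : ρ ≠ 0) :
    ∃ t : ℝ, ∀ Λ : Set (Space d), MeasurableSet Λ → volume Λ ≠ ⊤ → ∀ M : ℕ,
      (M : ℝ≥0∞) ≤ ρ * volume Λ → ∀ y : Fin M → Space d,
        ENNReal.ofReal (Real.exp (-t)) * (volume Λ / 4) ≤ ∫⁻ u in Λ, ∏ l, w (u - y l) := by
  have hlam0 : 0 ≤ lam := (Nat.cast_nonneg d).trans hlam.le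
  obtain ⟨A', D, hA', hDm, hD, hwD⟩ := exists_lower_bound_off_small_set hw h0 hR hlam0 hA
    -- With this `ε`, the at most `ρ * volume Λ` translates of `D` cover volume at most `volume Λ /
    -- 2`.
    (ε := (2 * ρ : ℝ≥0∞)⁻¹) (ENNReal.inv_ne_zero.2 (by finiteness))
  let ψ : Space d → ℝ≥0∞ := fun v => ENNReal.ofReal (A' * (1 + ‖v‖) ^ (-lam))
  have hψm : Measurable ψ := by fun_prop
  have hψ : ∫⁻ v, ψ v ≠ ⊤ := by
    have hi := (integrable_one_add_norm (E := Space d) (μ := volume) (r := lam)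
      (by simpa using hlam)).const_mul A'
    exact hi.lintegral_lt_top.ne
  obtain ⟨J, hJ⟩ := WithTop.ne_top_iff_exists.1 hψ
  replace hJ : (J : ℝ≥0∞) = ∫⁻ v, ψ v := hJ
  -- Markov's inequality then gives `volume B₂ ≤ volume Λ / 4`. The `+ 1` keeps `T` positive even if
  -- `J = 0`.
  let T : ℝ≥0 := 4 * ρ * (J + 1)
  refine ⟨T, fun Λ hΛ hΛf M hM y => ?_⟩
  let B₁ : Set (Space d) := ⋃ l, (fun u => u - y l) ⁻¹' D
  let f : Space d → ℝ≥0∞ := fun u => ∑ l, ψ (u - y l)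
  let B₂ : Set (Space d) := {u | (T : ℝ≥0∞) ≤ f u}
  have hfm : Measurable f := by fun_prop
  have hB₁m : MeasurableSet B₁ := MeasurableSet.iUnion fun l =>
    (measurable_id.sub_const (y l)) hDm
  have hB₂m : MeasurableSet B₂ := measurableSet_le measurable_const hfm
  have hB₁ : volume B₁ ≤ volume Λ / 2 := by
    calc volume B₁ ≤ ∑ l, volume ((fun u => u - y l) ⁻¹' D) := measure_iUnion_fintype_le _ _
      _ = M * volume D := by
        rw [Finset.sum_congr rfl fun l _ =>
          (measurePreserving_sub_right volume (y l)).measure_preimage hDm.nullMeasurableSet]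
        simp
      _ ≤ ρ * volume Λ * (2 * ρ : ℝ≥0∞)⁻¹ := by gcongr
      _ = volume Λ / 2 := by
        rw [ENNReal.mul_inv (by simp) (by simp), div_eq_mul_inv]
        have : (ρ : ℝ≥0∞) * (ρ : ℝ≥0∞)⁻¹ = 1 := ENNReal.mul_inv_cancel (by simpa) (by simp)
        calc ρ * volume Λ * (2⁻¹ * (ρ : ℝ≥0∞)⁻¹) = volume Λ * 2⁻¹ * (ρ * (ρ : ℝ≥0∞)⁻¹) := by ring
          _ = _ := by rw [this, mul_one]
  have hint : ∫⁻ u, f u ≤ ρ * volume Λ * J := by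
    calc ∫⁻ u, f u = ∑ l : Fin M, ∫⁻ u, ψ (u - y l) :=
          lintegral_finsetSum _ fun l _ => hψm.comp (measurable_id.sub_const _)
      _ = M * J := by simp [lintegral_sub_right_eq_self ψ, ← hJ]
      _ ≤ _ := by gcongr
  have hB₂ : volume B₂ ≤ volume Λ / 4 := by
    have h1 := (mul_meas_ge_le_lintegral (μ := volume) hfm (T : ℝ≥0∞)).trans hint
    have h2 : (ρ : ℝ≥0∞) * (J + 1) * (4 * volume B₂) ≤ ρ * (J + 1) * volume Λ := by
      calc (ρ : ℝ≥0∞) * (J + 1) * (4 * volume B₂) = T * volume B₂ := by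
            simp only [T]; push_cast; ring
        _ ≤ ρ * volume Λ * J := h1
        _ ≤ ρ * volume Λ * (J + 1) := by gcongr; exact le_self_add
        _ = _ := by ring
    have h3 : 4 * volume B₂ ≤ volume Λ := by
      rwa [ENNReal.mul_le_mul_iff_right] at h2
      · simp [hρ]
      · finiteness
    rwa [ENNReal.le_div_iff_mul_le (by simp) (by simp), mul_comm]
  have hgood : volume Λ / 4 ≤ volume (Λ \ (B₁ ∪ B₂)) := by
    have h1 : volume Λ ≤ volume (Λ \ (B₁ ∪ B₂)) + (volume Λ / 2 + volume Λ / 4) := by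
      calc volume Λ ≤ volume ((Λ \ (B₁ ∪ B₂)) ∪ (B₁ ∪ B₂)) :=
            measure_mono fun u hu => by
              by_cases hb : u ∈ B₁ ∪ B₂
              · exact Or.inr hb
              · exact Or.inl ⟨hu, hb⟩
        _ ≤ volume (Λ \ (B₁ ∪ B₂)) + (volume B₁ + volume B₂) :=
            (measure_union_le _ _).trans (by gcongr; exact measure_union_le _ _)
        _ ≤ _ := by gcongr
    have h2 : volume Λ = volume Λ / 4 + (volume Λ / 2 + volume Λ / 4) := by
      rw [add_left_comm, ENNReal.div_add_div_same]
      have : (volume Λ + volume Λ) / 4 = volume Λ / 2 := by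
        rw [← two_mul, show (4 : ℝ≥0∞) = 2 * 2 by norm_num,
          ENNReal.mul_div_mul_left _ _ (by simp) (by simp)]
      rw [this, ENNReal.add_halves]
    have h3 : volume Λ / 2 + volume Λ / 4 ≠ ⊤ := by finiteness
    exact ENNReal.le_of_add_le_add_right h3 (h2.symm.le.trans h1)
  have hGm : MeasurableSet (Λ \ (B₁ ∪ B₂)) := hΛ.diff (hB₁m.union hB₂m)
  calc ENNReal.ofReal (Real.exp (-T)) * (volume Λ / 4)
      ≤ ENNReal.ofReal (Real.exp (-T)) * volume (Λ \ (B₁ ∪ B₂)) := by gcongr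
    _ = ∫⁻ _u in Λ \ (B₁ ∪ B₂), ENNReal.ofReal (Real.exp (-T)) := by simp
    _ ≤ ∫⁻ u in Λ \ (B₁ ∪ B₂), ∏ l, w (u - y l) := by
        refine setLIntegral_mono' hGm fun u hu => ?_
        have hu₁ : ∀ l, u - y l ∉ D := fun l hl => hu.2 (Or.inl (Set.mem_iUnion.2 ⟨l, hl⟩))
        have hu₂ : f u < T := not_le.1 fun hc => hu.2 (Or.inr hc)
        have hsum : ∑ l, A' * (1 + ‖u - y l‖) ^ (-lam) ≤ T := by
          have : ENNReal.ofReal (∑ l, A' * (1 + ‖u - y l‖) ^ (-lam)) ≤ T := by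
            rw [ENNReal.ofReal_sum_of_nonneg fun i _ => by positivity]
            exact hu₂.le
          rw [← ENNReal.ofReal_coe_nnreal] at this
          exact (ENNReal.ofReal_le_ofReal_iff T.coe_nonneg).1 this
        calc ENNReal.ofReal (Real.exp (-T))
            ≤ ENNReal.ofReal (Real.exp (-∑ l, A' * (1 + ‖u - y l‖) ^ (-lam))) :=
              ENNReal.ofReal_le_ofReal (Real.exp_le_exp.2 (neg_le_neg hsum))
          _ = ∏ l, ENNReal.ofReal (Real.exp (-(A' * (1 + ‖u - y l‖) ^ (-lam)))) := by
              rw [← Finset.sum_neg_distrib, Real.exp_sum,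
                ENNReal.ofReal_prod_of_nonneg fun i _ => (Real.exp_pos _).le]
          _ ≤ _ := Finset.prod_le_prod' fun l _ => hwD _ (hu₁ l)
    _ ≤ ∫⁻ u in Λ, ∏ l, w (u - y l) := lintegral_mono_set Set.sdiff_subset

end Insertion

/-! ### Cubes of side `r`. -/

section Cubes

variable {d : ℕ}

/-- The index of the cube of side `r` that contains `u`. -/
def cell (r : ℝ) (u : Space d) : Fin d → ℤ := fun i => ⌊u i / r⌋

/-- The lower corner of the cube with index `j`. -/
def corner (r : ℝ) (j : Fin d → ℤ) : Space d := WithLp.toLp 2 fun i => r * j i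

theorem measurable_cell (r : ℝ) : Measurable (cell r : Space d → Fin d → ℤ) :=
  measurable_pi_lambda _ fun i => Int.measurable_floor.comp (by fun_prop)

theorem norm_le_mul_sqrt {r : ℝ} (hr : 0 ≤ r) {u : Space d} (hu : ∀ i, |u i| ≤ r) :
    ‖u‖ ≤ r * √d := by
  rw [EuclideanSpace.norm_eq]
  calc √(∑ i, ‖u i‖ ^ 2) ≤ √(∑ _i : Fin d, r ^ 2) := by
        refine Real.sqrt_le_sqrt (Finset.sum_le_sum fun i _ => ?_)
        exact pow_le_pow_left₀ (norm_nonneg _) (hu i) 2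
    _ = r * √d := by
        simp [Real.sqrt_sq hr, mul_comm]

theorem cell_eq_iff {r : ℝ} (hr : 0 < r) (u : Space d) (j : Fin d → ℤ) :
    cell r u = j ↔ ∀ i, r * j i ≤ u i ∧ u i < r * j i + r := by
  simp only [cell, funext_iff, Int.floor_eq_iff]
  refine forall_congr' fun i => ?_
  rw [le_div_iff₀ hr, div_lt_iff₀ hr, mul_comm, add_mul, one_mul, mul_comm r]

theorem norm_sub_corner_le {r : ℝ} (hr : 0 < r) (u : Space d) :
    ‖u - corner r (cell r u)‖ ≤ r * √d := by
  refine norm_le_mul_sqrt hr.le fun i => ?_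
  have := (cell_eq_iff hr u _).1 rfl i
  simp only [corner, PiLp.sub_apply]
  rw [abs_of_nonneg] <;> linarith

theorem norm_sub_le_of_cell_eq {r : ℝ} (hr : 0 < r) {u v : Space d} (h : cell r u = cell r v) :
    ‖u - v‖ ≤ r * √d := by
  refine norm_le_mul_sqrt hr.le fun i => ?_
  have h1 := (cell_eq_iff hr u _).1 h i
  have h2 := (cell_eq_iff hr v _).1 rfl i
  rw [PiLp.sub_apply, abs_le]
  constructor <;> linarith

theorem volume_cell {r : ℝ} (hr : 0 < r) (j : Fin d → ℤ) :
    volume (cell r ⁻¹' {j} : Set (Space d)) = ENNReal.ofReal r ^ d := by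
  have h : (cell r ⁻¹' {j} : Set (Space d)) = WithLp.ofLp ⁻¹'
      (Set.univ.pi fun i => Set.Ico (r * j i) (r * j i + r)) := by
    ext u
    simp only [Set.mem_preimage, Set.mem_singleton_iff, cell_eq_iff hr, Set.mem_pi,
      Set.mem_univ, true_implies, Set.mem_Ico]
  rw [h, (PiLp.volume_preserving_ofLp (Fin d)).measure_preimage
    (MeasurableSet.univ_pi fun i => measurableSet_Ico).nullMeasurableSet, Real.volume_pi_Ico]
  simp

/-- Comparison with an integral: a cube has diameter at most `1`, so moving from its corner to any
of its points changes `1 + ‖·‖` by a factor at most `2`. The division by `r ^ d`, the volume of a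
cube, is what (RP) has to beat. -/
theorem sum_corner_le {r : ℝ} (hr : 0 < r) (hr1 : r * √d ≤ 1) {m : ℝ} (hm : (d : ℝ) < m)
    (F : Finset (Fin d → ℤ)) (a : Fin d → ℤ) :
    ∑ j ∈ F, (1 + ‖corner r a - corner r j‖) ^ (-m) ≤
      2 ^ m * (∫ u : Space d, (1 + ‖u‖) ^ (-m)) / r ^ d := by
  have hm0 : 0 ≤ m := (Nat.cast_nonneg d).trans hm.le
  have hint : Integrable fun u : Space d => (1 + ‖u‖) ^ (-m) :=
    integrable_one_add_norm (by simpa using hm)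
  have hint' : Integrable fun u : Space d => (1 + ‖u - corner r a‖) ^ (-m) :=
    hint.comp_sub_right (corner r a)
  have hms : ∀ j, MeasurableSet (cell r ⁻¹' {j} : Set (Space d)) := fun j =>
    measurable_cell r (measurableSet_singleton j)
  have hone : ∀ j ∈ F, r ^ d * (1 + ‖corner r a - corner r j‖) ^ (-m) ≤
      ∫ u in (cell r ⁻¹' {j} : Set (Space d)), 2 ^ m * (1 + ‖u - corner r a‖) ^ (-m) := by
    intro j _
    have hc : ∫ _u in (cell r ⁻¹' {j} : Set (Space d)), (1 + ‖corner r a - corner r j‖) ^ (-m) =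
        r ^ d * (1 + ‖corner r a - corner r j‖) ^ (-m) := by
      rw [setIntegral_const, measureReal_def, volume_cell hr, ENNReal.toReal_pow,
        ENNReal.toReal_ofReal hr.le, smul_eq_mul]
    rw [← hc]
    refine setIntegral_mono_on (integrableOn_const (by
      rw [volume_cell hr]; finiteness)) ((hint'.const_mul _).integrableOn) (hms j) fun u hu => ?_
    have hu' : cell r u = j := hu
    have h1 : ‖u - corner r j‖ ≤ 1 := by
      rw [← hu']
      exact (norm_sub_corner_le hr u).trans hr1
    have h2 : 1 + ‖u - corner r a‖ ≤ 2 * (1 + ‖corner r a - corner r j‖) := by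
      have := norm_sub_le_norm_sub_add_norm_sub u (corner r j) (corner r a)
      rw [norm_sub_rev (corner r j)] at this
      linarith [norm_nonneg (corner r a - corner r j)]
    have h3 : (2 : ℝ) ^ m * (1 + ‖u - corner r a‖) ^ (-m) =
        ((1 + ‖u - corner r a‖) / 2) ^ (-m) := by
      rw [Real.div_rpow (by positivity) (by norm_num), Real.rpow_neg (by norm_num : (0:ℝ) ≤ 2),
        div_inv_eq_mul, mul_comm]
    rw [h3]
    exact Real.rpow_le_rpow_of_nonpos (by positivity) (by linarith) (by linarith)
  rw [le_div_iff₀ (by positivity), mul_comm, Finset.mul_sum]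
  refine (Finset.sum_le_sum hone).trans ?_
  rw [← integral_biUnion_finset F (fun j _ => hms j)
    (fun i _ j _ hij => Disjoint.preimage _ (by simpa using hij))
    fun j _ => (hint'.const_mul _).integrableOn]
  refine (setIntegral_le_integral (hint'.const_mul _) (Eventually.of_forall fun u =>
    by positivity)).trans (le_of_eq ?_)
  rw [integral_const_mul, integral_sub_right_eq_self fun u : Space d => (1 + ‖u‖) ^ (-m)]

/-- Keep one term of the exponential series, of order `k` with `ε * k ≥ q`. -/
theorem exists_stretched_exp_le {δ ε q : ℝ} (hδ : 0 < δ) (hε : 0 < ε) :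
    ∃ K : ℝ, 0 ≤ K ∧ ∀ s : ℝ, 1 ≤ s → Real.exp (-(δ * (s / 2) ^ ε)) ≤ K * s ^ (-q) := by
  obtain ⟨k, hk⟩ := exists_nat_gt (q / ε)
  have hk' : q ≤ ε * k := by
    rw [div_lt_iff₀ hε] at hk
    linarith
  refine ⟨k.factorial / δ ^ k * 2 ^ (ε * k), by positivity, fun s hs => ?_⟩
  have hs0 : 0 < s := by linarith
  rw [Real.exp_neg]
  have h2 : s ^ q ≤ s ^ (ε * k) := Real.rpow_le_rpow_of_exponent_le hs hk'
  have h3 : δ ^ k * s ^ q / (2 ^ (ε * k) * k.factorial) ≤ Real.exp (δ * (s / 2) ^ ε) := by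
    refine le_trans ?_ (Real.pow_div_factorial_le_exp (δ * (s / 2) ^ ε) (by positivity) k)
    rw [mul_pow, ← Real.rpow_natCast ((s / 2) ^ ε), ← Real.rpow_mul (by positivity),
      Real.div_rpow hs0.le (by norm_num), ← div_div, mul_div_assoc]
    gcongr
  calc (Real.exp (δ * (s / 2) ^ ε))⁻¹ ≤ (δ ^ k * s ^ q / (2 ^ (ε * k) * k.factorial))⁻¹ :=
        inv_anti₀ (by positivity) h3
    _ = _ := by
        rw [Real.rpow_neg hs0.le]
        field_simp

end Cubes

/-! ### The distance-dependent threshold and the Ruelle bound. -/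

section RuelleBound

variable {d : ℕ}

/-- The threshold for the number of particles in the cube with index `j`: it grows with the
distance from the points `x i`. -/
def threshold (r ε : ℝ) {n : ℕ} (x : Fin n → Space d) (j : Fin d → ℤ) : ℝ :=
  (1 + Metric.infDist (corner r j) (Set.range x)) ^ ε

theorem one_le_threshold {r ε : ℝ} (hε : 0 ≤ ε) {n : ℕ} (x : Fin n → Space d) (j : Fin d → ℤ) :
    1 ≤ threshold r ε x j :=
  Real.one_le_rpow (by linarith [Metric.infDist_nonneg (x := corner r j) (s := Set.range x)]) hε

/-- The threshold varies slowly, so that multiplying the attraction kernel by it only weakens the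
decay exponent by `ε`. -/
theorem threshold_le_mul {r ε : ℝ} (hε : 0 ≤ ε) {n : ℕ} (x : Fin n → Space d)
    (a j : Fin d → ℤ) :
    threshold r ε x j ≤ threshold r ε x a * (1 + ‖corner r a - corner r j‖) ^ ε := by
  have ha := Metric.infDist_nonneg (x := corner r a) (s := Set.range x)
  have hj := Metric.infDist_nonneg (x := corner r j) (s := Set.range x)
  have h := Metric.infDist_le_infDist_add_dist (x := corner r j) (y := corner r a)
    (s := Set.range x)
  rw [dist_comm, dist_eq_norm] at h
  unfold threshold
  rw [← Real.mul_rpow (by linarith) (by positivity)]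
  refine Real.rpow_le_rpow (by linarith) ?_ hε
  nlinarith [norm_nonneg (corner r a - corner r j)]

theorem threshold_cell_le {r ε : ℝ} (hr : 0 < r) (hr1 : r * √d ≤ 1) (hε : 0 ≤ ε) {n : ℕ}
    (x : Fin n → Space d) (i : Fin n) : threshold r ε x (cell r (x i)) ≤ 2 ^ ε := by
  have hj := Metric.infDist_nonneg (x := corner r (cell r (x i))) (s := Set.range x)
  have h := Metric.infDist_le_dist_of_mem (x := corner r (cell r (x i))) (Set.mem_range_self (f := x) i)
  rw [dist_comm, dist_eq_norm] at h
  have h2 := (norm_sub_corner_le hr (x i)).trans hr1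
  exact Real.rpow_le_rpow (by linarith) (by linarith) hε

theorem exists_threshold_cell_ge {r ε : ℝ} (hr : 0 < r) (hr1 : r * √d ≤ 1) (hε : 0 ≤ ε) {n : ℕ}
    (hn : 0 < n) (x : Fin n → Space d) (u : Space d) :
    ∃ i, ((1 + ‖u - x i‖) / 2) ^ ε ≤ threshold r ε x (cell r u) := by
  obtain ⟨_, ⟨i, rfl⟩, hi⟩ := (Set.finite_range x).isCompact.exists_infDist_eq_dist
    ⟨_, Set.mem_range_self (⟨0, hn⟩ : Fin n)⟩ (corner r (cell r u))
  refine ⟨i, ?_⟩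
  unfold threshold
  rw [hi, dist_eq_norm]
  refine Real.rpow_le_rpow (by positivity) ?_ hε
  have h1 := norm_sub_le_norm_sub_add_norm_sub u (corner r (cell r u)) (x i)
  have h2 := (norm_sub_corner_le hr u).trans hr1
  linarith [norm_nonneg (corner r (cell r u) - x i)]

theorem measurable_threshold_cell (r ε : ℝ) {n : ℕ} (x : Fin n → Space d) :
    Measurable fun u => threshold r ε x (cell r u) :=
  (measurable_of_countable (threshold r ε x)).comp (measurable_cell r)

/-- The nearest point `x i` controls the threshold, so the integrand is at most a sum of `n`
translates of one integrable function. A constant threshold would give a bound proportional to the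
volume instead. -/
theorem exists_lintegral_threshold_le {r ε δ : ℝ} (hr : 0 < r) (hr1 : r * √d ≤ 1) (hε : 0 < ε)
    (hδ : 0 < δ) :
    ∃ k : ℝ≥0, ∀ n : ℕ, 0 < n → ∀ x : Fin n → Space d,
      ∫⁻ u, ENNReal.ofReal (Real.exp (-(δ * threshold r ε x (cell r u)))) ≤ k * n := by
  obtain ⟨K, hK0, hK⟩ := exists_stretched_exp_le (q := d + 1) hδ hε
  let g : Space d → ℝ≥0∞ := fun u => ENNReal.ofReal (K * (1 + ‖u‖) ^ (-(d + 1 : ℝ)))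
  have hg : ∫⁻ u, g u ≠ ⊤ :=
    (((integrable_one_add_norm (E := Space d) (μ := volume) (r := d + 1)
      (by simp)).const_mul K).lintegral_lt_top).ne
  obtain ⟨k, hk⟩ := WithTop.ne_top_iff_exists.1 hg
  replace hk : (k : ℝ≥0∞) = ∫⁻ u, g u := hk
  refine ⟨k, fun n hn x => ?_⟩
  calc ∫⁻ u, ENNReal.ofReal (Real.exp (-(δ * threshold r ε x (cell r u))))
      ≤ ∫⁻ u, ∑ i, g (u - x i) := by
        refine lintegral_mono fun u => ?_
        obtain ⟨i, hi⟩ := exists_threshold_cell_ge hr hr1 hε.le hn x u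
        refine le_trans (ENNReal.ofReal_le_ofReal ?_)
          (Finset.single_le_sum (f := fun i => g (u - x i)) (fun _ _ => zero_le)
            (Finset.mem_univ i))
        refine le_trans (Real.exp_le_exp.2 ?_) (hK (1 + ‖u - x i‖) (by simp))
        exact neg_le_neg (mul_le_mul_of_nonneg_left hi hδ.le)
    _ = ∑ i : Fin n, ∫⁻ u, g (u - x i) :=
        lintegral_finsetSum _ fun i _ => by fun_prop
    _ = k * n := by simp [lintegral_sub_right_eq_self g, ← hk, mul_comm]

theorem exists_ruelle_bound (hd : 1 ≤ d) {w : Space d → ℝ≥0∞} (hw : Measurable w)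
    (h0 : ∀ᵐ v, w v ≠ 0) {A R lam C₀ : ℝ} (hR : 0 < R) (hlam : (d : ℝ) < lam) (hC₀ : 0 ≤ C₀)
    (hA : ∀ v : Space d, R ≤ ‖v‖ → ENNReal.ofReal (Real.exp (-(A * ‖v‖ ^ (-lam)))) ≤ w v)
    (hup : ∀ v, w v ≤ ENNReal.ofReal (Real.exp (C₀ * (1 + ‖v‖) ^ (-lam))))
    (hrep : ∀ K : ℝ, ∀ᶠ t in 𝓝[>] (0 : ℝ), ∃ G : ℝ, K ≤ G * t ^ d ∧
      ∀ v : Space d, ‖v‖ ≤ t → w v ≤ ENNReal.ofReal (Real.exp (-G)))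
    {ρ : ℝ≥0} (hρ : ρ ≠ 0) :
    ∃ ξ : ℝ≥0, ∀ Λ : Set (Space d), MeasurableSet Λ → volume Λ ≠ ⊤ → ∀ N n : ℕ, 0 < n → n ≤ N →
      (N : ℝ≥0∞) ≤ ρ * volume Λ → ∀ (x : Fin n → Space d) (D : Finset (Fin n × Fin n)),
      D ⊆ (Finset.univ.filter fun p => p.1 < p.2) → D.card ≤ n →
      (N.descFactorial n : ℝ≥0∞) * ∫⁻ y, (∏ p ∈ (Finset.univ.filter
            fun p : Fin n × Fin n => p.1 < p.2) \ D, w (x p.1 - x p.2)) *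
          (∏ i, ∏ l, w (x i - y l)) * pairWeight (fun u v => w (u - v)) y
            ∂Measure.pi (fun _ : Fin (N - n) => volume.restrict Λ) ≤
        (ξ : ℝ≥0∞) ^ n * partitionIntegral (volume.restrict Λ) (fun u v => w (u - v)) N := by
  obtain ⟨T, hT⟩ := exists_insertion_bound hw h0 hR hlam hA hρ
  have hlam0 : 0 ≤ lam := (Nat.cast_nonneg d).trans hlam.le
  have hd0 : (0 : ℝ) < d := by exact_mod_cast hd
  -- Half of the excess decay goes to the growth of the threshold; the remaining exponent `m` still
  -- exceeds `d`.
  set ε : ℝ := (lam - d) / 2 with hε_def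
  have hε : 0 < ε := by simp only [hε_def]; linarith
  set m : ℝ := lam - ε with hm_def
  have hm : (d : ℝ) < m := by simp only [hm_def, hε_def]; linarith
  set J : ℝ := ∫ u : Space d, (1 + ‖u‖) ^ (-m)
  have hJ : 0 ≤ J := integral_nonneg fun u => by positivity
  -- Passing from two points to the corners of their cubes adds at most `2` to the distance, and `3
  -- + s ≤ 3 * (1 + s)`.
  set C₁ : ℝ := C₀ * 3 ^ lam
  have hC₁ : 0 ≤ C₁ := by positivity
  -- Here `t` will be the diagonal of the cubes. The required value is `12 * C * t ^ d`, which does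
  -- not depend on `t`; the extra `1` makes `G` positive even when `C = 0`.
  obtain ⟨t, ⟨G, hGt, hG⟩, ht0, ht1⟩ := ((hrep (12 * (C₁ * (2 ^ m * J * √d ^ d)) + 1)).and
    (Ioo_mem_nhdsGT (zero_lt_one' ℝ))).exists
  have hsd : 0 < √(d : ℝ) := Real.sqrt_pos.2 hd0
  set r : ℝ := t / √d
  have hr : 0 < r := by positivity
  have hrt : r * √d = t := by simp only [r]; field_simp
  have hr1 : r * √d ≤ 1 := by rw [hrt]; exact ht1.le
  set C : ℝ := C₁ * (2 ^ m * J / r ^ d) with hC_def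
  have hC0 : 0 ≤ C := by positivity
  have hCt : C * t ^ d = C₁ * (2 ^ m * J * √d ^ d) := by
    simp only [hC_def, r, div_pow]
    field_simp
  have hG12 : 12 * C < G := by
    refine lt_of_mul_lt_mul_right ?_ (pow_pos ht0 d).le
    calc 12 * C * t ^ d = 12 * (C₁ * (2 ^ m * J * √d ^ d)) := by rw [mul_assoc, hCt]
      _ < _ := by linarith
  have hGpos : 0 < G := by linarith
  obtain ⟨k, hk⟩ := exists_lintegral_threshold_le (δ := G / 8) hr hr1 hε (by positivity)
  let b : (Fin d → ℤ) → (Fin d → ℤ) → ℝ := fun a j =>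
    C₁ * (1 + ‖corner r a - corner r j‖) ^ (-lam)
  have hb : ∀ a j, 0 ≤ b a j := fun a j => by positivity
  have hbC : ∀ (F : Finset (Fin d → ℤ)) (a : Fin d → ℤ), ∑ j ∈ F, b a j ≤ C := fun F a => by
    rw [hC_def]
    refine le_trans ?_ (mul_le_mul_of_nonneg_left (sum_corner_le hr hr1 hm F a) hC₁)
    rw [Finset.mul_sum]
    refine Finset.sum_le_sum fun j _ => mul_le_mul_of_nonneg_left ?_ hC₁
    exact Real.rpow_le_rpow_of_exponent_le (by simp) (by simp only [hm_def]; linarith)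
  have hW : ∀ u v, w (u - v) ≤
      ENNReal.ofReal (Real.exp (-cellEnergy G b (cell r u) (cell r v))) := fun u v => by
    unfold cellEnergy
    split_ifs with h
    · refine (hG (u - v) ((norm_sub_le_of_cell_eq hr h).trans hrt.le)).trans
        (ENNReal.ofReal_le_ofReal (Real.exp_le_exp.2 ?_))
      linarith [hb (cell r u) (cell r v)]
    · refine (hup (u - v)).trans (ENNReal.ofReal_le_ofReal (Real.exp_le_exp.2 ?_))
      rw [zero_sub, neg_neg]
      have h1 := (norm_sub_corner_le hr u).trans hr1
      have h2 := (norm_sub_corner_le hr v).trans hr1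
      have h3 : ‖corner r (cell r u) - corner r (cell r v)‖ ≤ 1 + ‖u - v‖ + 1 := by
        rw [norm_sub_rev] at h1
        have e : corner r (cell r u) - corner r (cell r v) =
          (corner r (cell r u) - u) + (u - v) + (v - corner r (cell r v)) := by abel
        rw [e]
        refine (norm_add_le _ _).trans (add_le_add ((norm_add_le _ _).trans ?_) h2)
        gcongr
      simp only [b, C₁, mul_assoc]
      refine mul_le_mul_of_nonneg_left ?_ hC₀
      have e : (3 : ℝ) ^ lam * (1 + ‖corner r (cell r u) - corner r (cell r v)‖) ^ (-lam) =
          ((1 + ‖corner r (cell r u) - corner r (cell r v)‖) / 3) ^ (-lam) := by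
        rw [Real.div_rpow (by positivity) (by norm_num), Real.rpow_neg (by norm_num : (0:ℝ) ≤ 3),
          div_inv_eq_mul, mul_comm]
      rw [e]
      exact Real.rpow_le_rpow_of_nonpos (by positivity) (by linarith [norm_nonneg (u - v)])
        (by linarith)
  -- Chosen so that `ρ * volume Λ = a * v`, with `v = exp (-T) * (volume Λ / 4)` the insertion
  -- bound.
  let a : ℝ≥0 := 4 * ρ * (Real.exp T).toNNReal
  refine ⟨(Real.exp (C / 2 + C * 2 ^ ε + G)).toNNReal * (a * (Real.exp (a * k)).toNNReal),
    fun Λ hΛ hΛf N n hn hnN hN x D hD hDn => ?_⟩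
  have hv : (N : ℝ≥0∞) ≤ a * (ENNReal.ofReal (Real.exp (-T)) * (volume Λ / 4)) := by
    refine hN.trans (le_of_eq ?_)
    have e1 : ENNReal.ofReal (Real.exp T) * ENNReal.ofReal (Real.exp (-T)) = 1 := by
      rw [← ENNReal.ofReal_mul (Real.exp_pos _).le, ← Real.exp_add]; simp
    have e2 : 4 * (volume Λ / 4) = volume Λ := ENNReal.mul_div_cancel (by simp) (by simp)
    calc ρ * volume Λ = ρ * (4 * (volume Λ / 4)) *
          (ENNReal.ofReal (Real.exp T) * ENNReal.ofReal (Real.exp (-T))) := by rw [e1, e2, mul_one]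
      _ = 4 * ρ * ENNReal.ofReal (Real.exp T) *
          (ENNReal.ofReal (Real.exp (-T)) * (volume Λ / 4)) := by ring
      _ = _ := by simp only [a]; push_cast; rfl
  have hWm : Measurable (Function.uncurry fun u v : Space d => w (u - v)) :=
    hw.comp (measurable_fst.sub measurable_snd)
  have key := descFactorial_mul_lintegral_le (volume.restrict Λ) hWm (cell r) b
    (threshold r ε x) G C (2 ^ ε) hC0 hb
    (fun a j => by simp only [b, norm_sub_rev (corner r a)]) hbC ?_
    (one_le_threshold hε.le x) hG12.le hW hnN x (fun i => threshold_cell_le hr hr1 hε.le x i)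
    D hD hDn hv (fun M hM y => hT Λ hΛ hΛf M ((by exact_mod_cast hM :
      (M : ℝ≥0∞) ≤ N).trans hN) y) (measurable_threshold_cell r ε x)
    ((setLIntegral_le_lintegral _ _).trans (hk n hn x))
  · refine key.trans (le_of_eq ?_)
    push_cast
    rfl
  · intro F a
    calc ∑ j ∈ F, b a j * threshold r ε x j
        ≤ ∑ j ∈ F, C₁ * threshold r ε x a * (1 + ‖corner r a - corner r j‖) ^ (-m) := by
          refine Finset.sum_le_sum fun j _ => ?_
          refine (mul_le_mul_of_nonneg_left (threshold_le_mul hε.le x a j) (hb a j)).trans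
            (le_of_eq ?_)
          rw [show -m = -lam + ε by simp only [hm_def]; ring,
            Real.rpow_add (by positivity)]
          ring
      _ ≤ C₁ * threshold r ε x a * (2 ^ m * J / r ^ d) := by
          rw [← Finset.mul_sum]
          refine mul_le_mul_of_nonneg_left (sum_corner_le hr hr1 hm F a) ?_
          exact mul_nonneg hC₁ (zero_le_one.trans (one_le_threshold hε.le x a))
      _ = C * threshold r ε x a := by rw [hC_def]; ring

end RuelleBound

/-! ### From pair weights to the potential and its correlation functions. -/

section Potential

variable {d : ℕ}

/-- The Boltzmann factor of a pair of particles with difference `v`; it vanishes at `v = 0`. -/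
def pairBoltzmann (φ : Space d → EReal) (β : ℝ) (v : Space d) : ℝ≥0∞ :=
  if v = 0 then 0 else ENNReal.ofReal (Real.exp (-(β * (φ v).toReal)))

theorem measurable_pairBoltzmann {φ : Space d → EReal} (hφ : Measurable φ) (β : ℝ) :
    Measurable (pairBoltzmann φ β) :=
  Measurable.ite (measurableSet_singleton 0) measurable_const
    ((Real.measurable_exp.comp ((measurable_ereal_toReal.comp hφ).const_mul β).neg).ennreal_ofReal)

theorem pairBoltzmann_ne_zero_ae (hd : 1 ≤ d) (φ : Space d → EReal) (β : ℝ) :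
    ∀ᵐ v, pairBoltzmann φ β v ≠ 0 := by
  have : Nonempty (Fin d) := ⟨⟨0, hd⟩⟩
  have : ∀ᵐ v : Space d, v ≠ 0 := by simp [ae_iff]
  filter_upwards [this] with v hv
  simp [pairBoltzmann, hv, Real.exp_pos]

theorem coe_sum_toReal {ι : Type*} (s : Finset ι) (f : ι → EReal) (h : ∀ i ∈ s, f i ≠ ⊤)
    (h' : ∀ i ∈ s, f i ≠ ⊥) : ∑ i ∈ s, f i = ((∑ i ∈ s, (f i).toReal : ℝ) : EReal) := by
  induction s using Finset.cons_induction with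
  | empty => simp
  | cons i s hi ih =>
    rw [Finset.sum_cons, Finset.sum_cons, EReal.coe_add,
      ih (fun j hj => h j (Finset.mem_cons_of_mem hj))
        (fun j hj => h' j (Finset.mem_cons_of_mem hj)),
      EReal.coe_toReal (h i (Finset.mem_cons_self i s)) (h' i (Finset.mem_cons_self i s))]

theorem sum_eq_top {ι : Type*} (s : Finset ι) (f : ι → EReal) (h' : ∀ i ∈ s, f i ≠ ⊥)
    {i : ι} (hi : i ∈ s) (h : f i = ⊤) : ∑ i ∈ s, f i = ⊤ := by
  classical
  rw [← Finset.add_sum_erase s f hi, h]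
  refine EReal.top_add_of_ne_bot ?_
  refine Finset.sum_induction _ (· ≠ ⊥) (fun a b ha hb => ?_) (by simp)
    fun j hj => h' j (Finset.mem_of_mem_erase hj)
  simp [EReal.add_eq_bot_iff, ha, hb]

/-- Setting the pair weight to `0` at the origin makes the repulsion estimate valid there too. It
changes the weight at most on configurations with coincident points, which form a null set. -/
theorem boltzmann_of_injective {φ : Space d → EReal} (hφ : IsPairPotential φ) (β : ℝ) {m : ℕ}
    {z : Fin m → Space d} (hz : Function.Injective z) :
    boltzmann φ β z = pairWeight (fun u v => pairBoltzmann φ β (u - v)) z := by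
  have hne : ∀ p ∈ (Finset.univ.filter fun p : Fin m × Fin m => p.1 < p.2),
      z p.1 - z p.2 ≠ 0 := fun p hp => by
    rw [sub_ne_zero]
    exact hz.ne (Finset.mem_filter.1 hp).2.ne
  rw [boltzmann, energy, coe_sum_toReal _ _ (fun p hp => hφ.ne_top _ (hne p hp))
    fun p _ => hφ.ne_bot _, ← EReal.coe_mul, ← EReal.coe_neg, EReal.exp_coe, pairWeight,
    Finset.mul_sum, ← Finset.sum_neg_distrib, Real.exp_sum,
    ENNReal.ofReal_prod_of_nonneg fun i _ => (Real.exp_pos _).le]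
  refine Finset.prod_congr rfl fun p hp => ?_
  rw [pairBoltzmann, if_neg (hne p hp)]

theorem boltzmann_of_not_injective {φ : Space d → EReal} (hφ : IsPairPotential φ) {β : ℝ}
    (hβ : 0 < β) (h0 : φ 0 = ⊤) {m : ℕ} {z : Fin m → Space d} (hz : ¬ Function.Injective z) :
    boltzmann φ β z = 0 := by
  have : ∃ p ∈ (Finset.univ.filter fun p : Fin m × Fin m => p.1 < p.2), z p.1 = z p.2 := by
    simp only [Function.Injective, not_forall] at hz
    obtain ⟨i, j, hij, hne⟩ := hz
    rcases lt_or_gt_of_ne hne with h | h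
    · exact ⟨(i, j), by simpa using h, hij⟩
    · exact ⟨(j, i), by simpa using h, hij.symm⟩
  obtain ⟨p, hp, hzp⟩ := this
  rw [boltzmann, energy, sum_eq_top _ _ (fun p _ => hφ.ne_bot _) hp (by rw [hzp, sub_self, h0]),
    EReal.coe_mul_top_of_pos hβ, EReal.neg_top, EReal.exp_bot]

theorem boltzmann_zero_beta (φ : Space d → EReal) {m : ℕ} (z : Fin m → Space d) :
    boltzmann φ 0 z = 1 := by
  simp [boltzmann]

/-- Coincidence of two given coordinates defines a proper subspace because `d ≥ 1`. -/
theorem ae_injective (hd : 1 ≤ d) (M : ℕ) : ∀ᵐ y : Fin M → Space d, Function.Injective y := by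
  have : Nonempty (Fin d) := ⟨⟨0, hd⟩⟩
  have h : ∀ i j : Fin M, ∀ᵐ y : Fin M → Space d, i ≠ j → y i ≠ y j := fun i j => by
    by_cases hij : i = j
    · simp [hij]
    · let s : Submodule ℝ (Fin M → Space d) :=
        LinearMap.ker (LinearMap.proj (R := ℝ) (φ := fun _ : Fin M => Space d) i -
          LinearMap.proj j)
      have hs : s ≠ ⊤ := fun hs => by
        obtain ⟨e, he⟩ := exists_ne (0 : Space d)
        have : (Pi.single i e : Fin M → Space d) ∈ s := hs ▸ Submodule.mem_top
        simp [s, Pi.single_eq_of_ne' hij, he] at this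
      have h0 := Measure.addHaar_submodule volume s hs
      refine ae_iff.2 (measure_mono_null (fun y hy => ?_) h0)
      simp only [ne_eq, Set.mem_ofPred_eq, Classical.not_imp, not_not] at hy
      simp [s, hy.2]
  filter_upwards [ae_all_iff.2 fun i => ae_all_iff.2 fun j => h i j] with y hy i j hij
  by_contra hne
  exact hy i j hne hij

theorem ae_append_injective (hd : 1 ≤ d) {n : ℕ} {x : Fin n → Space d}
    (hx : Function.Injective x) (M : ℕ) :
    ∀ᵐ y : Fin M → Space d, Function.Injective (Fin.append x y) := by
  have : Nonempty (Fin d) := ⟨⟨0, hd⟩⟩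
  have h : ∀ (i : Fin n) (l : Fin M), ∀ᵐ y : Fin M → Space d, y l ≠ x i := fun i l => by
    rw [ae_iff]
    simpa [volume_pi] using Measure.pi_hyperplane (fun _ : Fin M => (volume : Measure (Space d))) l (x i)
  filter_upwards [ae_injective hd M, ae_all_iff.2 fun i => ae_all_iff.2 fun l => h i l]
    with y hy hxy
  exact Fin.append_injective_iff.2 ⟨hx, hy, fun i l hil => hxy i l hil.symm⟩

theorem restrict_power (Λ : Set (Space d)) (m : ℕ) :
    (volume : Measure (Fin m → Space d)).restrict (power Λ m) =
      Measure.pi fun _ => volume.restrict Λ := by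
  have : power Λ m = Set.univ.pi fun _ => Λ := by ext; simp [power]
  rw [this, volume_pi, Measure.restrict_pi_pi]

theorem partitionFunction_eq (hd : 1 ≤ d) {φ : Space d → EReal} (hφ : IsPairPotential φ) (β : ℝ)
    (Λ : Set (Space d)) (N : ℕ) :
    partitionFunction φ β Λ N =
      partitionIntegral (volume.restrict Λ) (fun u v => pairBoltzmann φ β (u - v)) N := by
  rw [partitionFunction, partitionIntegral, ← restrict_power]
  refine lintegral_congr_ae (ae_restrict_of_ae ?_)
  filter_upwards [ae_injective hd N] with y hy
  exact boltzmann_of_injective hφ β hy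

theorem exists_pairBoltzmann_le {φ : Space d → EReal} (hφ : IsPairPotential φ)
    (hBB : BddBelowBy φ) {β : ℝ} (hβ : 0 ≤ β) {A R lam : ℝ} (hR : 0 < R) (hlam : 0 ≤ lam)
    (hA : ∀ x : Space d, R ≤ ‖x‖ → ((-(A * ‖x‖ ^ (-lam)) : ℝ) : EReal) ≤ φ x) :
    ∃ C : ℝ, 0 ≤ C ∧ ∀ v,
      pairBoltzmann φ β v ≤ ENNReal.ofReal (Real.exp (C * (1 + ‖v‖) ^ (-lam))) := by
  obtain ⟨B, hB0, hB⟩ := hBB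
  obtain ⟨C, hC, hC₁, hC₂⟩ := exists_decay_bound hR hlam hB0 A
  refine ⟨β * C, mul_nonneg hβ hC, fun v => ?_⟩
  by_cases hv : v = 0
  · simp [pairBoltzmann, hv]
  rw [pairBoltzmann, if_neg hv]
  refine ENNReal.ofReal_le_ofReal (Real.exp_le_exp.2 ?_)
  have hreal : ∀ a : ℝ, (a : EReal) ≤ φ v → a ≤ (φ v).toReal := fun a ha => by
    rwa [← EReal.coe_le_coe_iff, EReal.coe_toReal (hφ.ne_top v hv) (hφ.ne_bot v)]
  have : -(φ v).toReal ≤ C * (1 + ‖v‖) ^ (-lam) := by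
    by_cases hvR : ‖v‖ < R
    · linarith [hreal _ (hB v), hC₁ _ (norm_nonneg v) hvR]
    · linarith [hreal _ (hA v (not_lt.1 hvR)), hC₂ _ (not_lt.1 hvR)]
  calc -(β * (φ v).toReal) = β * -(φ v).toReal := by ring
    _ ≤ β * (C * (1 + ‖v‖) ^ (-lam)) := mul_le_mul_of_nonneg_left this hβ
    _ = _ := by ring

theorem le_pairBoltzmann {φ : Space d → EReal} (hφ : IsPairPotential φ) {β : ℝ} (hβ : 0 ≤ β)
    {A R lam : ℝ} (hR : 0 < R)
    (hA : ∀ x : Space d, R ≤ ‖x‖ → φ x ≤ ((A * ‖x‖ ^ (-lam) : ℝ) : EReal)) (v : Space d)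
    (hv : R ≤ ‖v‖) :
    ENNReal.ofReal (Real.exp (-(β * A * ‖v‖ ^ (-lam)))) ≤ pairBoltzmann φ β v := by
  have hv0 : v ≠ 0 := norm_pos_iff.1 (hR.trans_le hv)
  rw [pairBoltzmann, if_neg hv0]
  refine ENNReal.ofReal_le_ofReal (Real.exp_le_exp.2 (neg_le_neg ?_))
  rw [mul_assoc]
  refine mul_le_mul_of_nonneg_left ?_ hβ
  have := hA v hv
  rwa [← EReal.coe_toReal (hφ.ne_top v hv0) (hφ.ne_bot v), EReal.coe_le_coe_iff] at this

/-- Take `G = β * Φ t`: monotonicity of `Φ` carries the bound at distance `t` to all smaller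
distances. -/
theorem eventually_pairBoltzmann_le {φ : Space d → EReal} (hφ : IsPairPotential φ)
    (hRP : Repulsive φ) {β : ℝ} (hβ : 0 < β) (K : ℝ) :
    ∀ᶠ t in 𝓝[>] (0 : ℝ), ∃ G : ℝ, K ≤ G * t ^ d ∧ ∀ v : Space d, ‖v‖ ≤ t →
      pairBoltzmann φ β v ≤ ENNReal.ofReal (Real.exp (-G)) := by
  obtain ⟨Φ, R₁, hR₁, -, hanti, -, hlim, hle, -⟩ := hRP
  filter_upwards [hlim.eventually_ge_atTop (K / β), Ioo_mem_nhdsGT hR₁] with t ht htR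
  refine ⟨β * Φ t, ?_, fun v hv => ?_⟩
  · rw [div_le_iff₀ hβ] at ht
    linarith
  · by_cases hv0 : v = 0
    · simp [pairBoltzmann, hv0]
    rw [pairBoltzmann, if_neg hv0]
    refine ENNReal.ofReal_le_ofReal (Real.exp_le_exp.2 (neg_le_neg
      (mul_le_mul_of_nonneg_left ?_ hβ.le)))
    have hvp : 0 < ‖v‖ := norm_pos_iff.2 hv0
    have h1 := hle v hvp (hv.trans htR.2.le)
    rw [← EReal.coe_toReal (hφ.ne_top v hv0) (hφ.ne_bot v), EReal.coe_le_coe_iff] at h1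
    exact (hanti hvp htR.1 hv).trans h1

/-- The pairs that contain the index `i`. -/
def pairsThrough {n : ℕ} (i : Fin n) : Finset (Fin n × Fin n) :=
  (Finset.univ.filter fun p => p.1 < p.2).filter fun p => p.1 = i ∨ p.2 = i

theorem card_pairsThrough_le {n : ℕ} (i : Fin n) : (pairsThrough i).card ≤ n := by
  have : pairsThrough i ⊆
      Finset.univ.image fun j : Fin n => if j < i then (j, i) else (i, j) := fun p hp => by
    simp only [pairsThrough, Finset.mem_filter, Finset.mem_univ, true_and] at hp
    simp only [Finset.mem_image, Finset.mem_univ, true_and]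
    obtain ⟨hlt, rfl | rfl⟩ := hp
    · exact ⟨p.2, by simp [hlt.not_gt]⟩
    · exact ⟨p.1, by simp [hlt]⟩
  refine (Finset.card_le_card this).trans (Finset.card_image_le.trans (by simp))

theorem sum_pairsThrough {n : ℕ} (s : Fin n × Fin n → ℝ) :
    ∑ i, ∑ p ∈ pairsThrough i, s p = 2 * ∑ p : Fin n × Fin n with p.1 < p.2, s p := by
  simp only [pairsThrough, Finset.sum_filter _ _ (s := Finset.univ.filter _)]
  rw [Finset.sum_comm, Finset.mul_sum]
  refine Finset.sum_congr rfl fun p hp => ?_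
  have hne : p.1 ≠ p.2 := (Finset.mem_filter.1 hp).2.ne
  have : ∀ i, (if p.1 = i ∨ p.2 = i then s p else 0) =
      (if p.1 = i then s p else 0) + if p.2 = i then s p else 0 := fun i => by
    by_cases h1 : p.1 = i
    · have h2 : p.2 ≠ i := fun h2 => hne (h1.trans h2.symm)
      simp [h1, h2]
    · simp [h1]
  simp only [this, Finset.sum_add_distrib, Finset.sum_ite_eq, Finset.mem_univ, if_true]
  ring

/-- Each pair passes through two indices, so `2 / n` times the total is the average over `i`. -/
theorem exists_pairsThrough_le {n : ℕ} (hn : 0 < n) (s : Fin n × Fin n → ℝ) :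
    ∃ i, 2 / (n : ℝ) * ∑ p : Fin n × Fin n with p.1 < p.2, s p ≤ ∑ p ∈ pairsThrough i, s p := by
  obtain ⟨i, -, hi⟩ := Finset.exists_le_of_sum_le (s := (Finset.univ : Finset (Fin n)))
    (f := fun _ => 2 / (n : ℝ) * ∑ p : Fin n × Fin n with p.1 < p.2, s p)
    (g := fun i => ∑ p ∈ pairsThrough i, s p) ⟨⟨0, hn⟩, Finset.mem_univ _⟩ (by
      rw [sum_pairsThrough, Finset.sum_const, Finset.card_univ, Fintype.card_fin, nsmul_eq_mul]
      refine le_of_eq ?_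
      field_simp)
  exact ⟨i, hi⟩

/-- The right-hand side of the improved Ruelle bound, without the constant. -/
def repulsionFactor (φ : Space d → EReal) (β : ℝ) {n : ℕ} (x : Fin n → Space d) : ℝ≥0∞ :=
  EReal.exp (-(((2 / (n : ℝ) : ℝ) : EReal) *
    ∑ p : Fin n × Fin n with p.1 < p.2, (β : EReal) * φ (x p.1 - x p.2)))

theorem exists_prod_pairsThrough_le {φ : Space d → EReal} (hφ : IsPairPotential φ) (β : ℝ) {n : ℕ}
    (hn : 0 < n) {x : Fin n → Space d} (hx : Function.Injective x) :
    ∃ i, ∏ p ∈ pairsThrough i, pairBoltzmann φ β (x p.1 - x p.2) ≤ repulsionFactor φ β x := by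
  have hne : ∀ p ∈ (Finset.univ.filter fun p : Fin n × Fin n => p.1 < p.2),
      x p.1 - x p.2 ≠ 0 := fun p hp => by
    rw [sub_ne_zero]
    exact hx.ne (Finset.mem_filter.1 hp).2.ne
  let s : Fin n × Fin n → ℝ := fun p => β * (φ (x p.1 - x p.2)).toReal
  have hs : ∀ p ∈ (Finset.univ.filter fun p : Fin n × Fin n => p.1 < p.2),
      (β : EReal) * φ (x p.1 - x p.2) = (s p : EReal) := fun p hp => by
    simp only [s]
    rw [EReal.coe_mul, EReal.coe_toReal (hφ.ne_top _ (hne p hp)) (hφ.ne_bot _)]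
  obtain ⟨i, hi⟩ := exists_pairsThrough_le hn s
  refine ⟨i, ?_⟩
  rw [repulsionFactor, Finset.sum_congr rfl hs, coe_sum_toReal _ _ (by simp) (by simp)]
  simp only [EReal.toReal_coe]
  rw [← EReal.coe_mul, ← EReal.coe_neg, EReal.exp_coe]
  refine (prod_le_ofReal_exp _ _ s fun p hp => ?_).trans
    (ENNReal.ofReal_le_ofReal (Real.exp_le_exp.2 (neg_le_neg hi)))
  rw [pairBoltzmann, if_neg (hne p (Finset.mem_filter.1 hp).1)]

theorem correlation_eq {φ : Space d → EReal} {β : ℝ} {Λ : Set (Space d)} {N n : ℕ} (hn : 0 < n)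
    (hnN : n ≤ N) (x : Fin n → Space d) :
    correlation φ β Λ n N x = (N.descFactorial n : ℝ≥0∞) *
      (∫⁻ y in power Λ (N - n), boltzmann φ β (Fin.append x y)) / partitionFunction φ β Λ N := by
  rw [correlation, if_neg hn.ne', if_neg (by omega), ENNReal.mul_div_right_comm]

theorem correlation_zero_beta_le {φ : Space d → EReal} {Λ : Set (Space d)} {ρ : ℝ≥0} {N n : ℕ}
    (hn : 0 < n) (hnN : n ≤ N) (hN : (N : ℝ≥0∞) ≤ ρ * volume Λ) (x : Fin n → Space d) :
    correlation φ 0 Λ n N x ≤ (ρ : ℝ≥0∞) ^ n := by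
  have hone : ∀ m, ∫⁻ _y in power Λ m, (1 : ℝ≥0∞) = volume Λ ^ m := fun m => by
    rw [restrict_power]
    simp [Measure.pi_univ]
  rw [correlation_eq hn hnN, partitionFunction]
  simp only [boltzmann_zero_beta, hone]
  refine ENNReal.div_le_of_le_mul ?_
  calc (N.descFactorial n : ℝ≥0∞) * volume Λ ^ (N - n) ≤
        (ρ * volume Λ) ^ n * volume Λ ^ (N - n) := by
        gcongr
        refine le_trans ?_ (pow_le_pow_left' hN n)
        exact_mod_cast Nat.descFactorial_le_pow N n
    _ = (ρ : ℝ≥0∞) ^ n * volume Λ ^ N := by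
        rw [mul_pow, mul_assoc, ← pow_add, Nat.add_sub_cancel' hnN]

theorem lintegral_boltzmann_append (hd : 1 ≤ d) {φ : Space d → EReal} (hφ : IsPairPotential φ)
    (β : ℝ) (Λ : Set (Space d)) {n : ℕ} {x : Fin n → Space d} (hx : Function.Injective x) (M : ℕ)
    {D : Finset (Fin n × Fin n)} (hD : D ⊆ Finset.univ.filter fun p => p.1 < p.2) :
    ∫⁻ y in power Λ M, boltzmann φ β (Fin.append x y) =
      (∏ p ∈ D, pairBoltzmann φ β (x p.1 - x p.2)) *
        ∫⁻ y, (∏ p ∈ (Finset.univ.filter fun p : Fin n × Fin n => p.1 < p.2) \ D,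
            pairBoltzmann φ β (x p.1 - x p.2)) *
          (∏ i, ∏ l, pairBoltzmann φ β (x i - y l)) *
          pairWeight (fun u v => pairBoltzmann φ β (u - v)) y
            ∂Measure.pi (fun _ : Fin M => volume.restrict Λ) := by
  have hfin : ∀ v, pairBoltzmann φ β v ≠ ⊤ := fun v => by
    unfold pairBoltzmann
    split_ifs <;> simp
  rw [← lintegral_const_mul' _ _ (ENNReal.prod_ne_top fun p _ => hfin _), ← restrict_power]
  refine lintegral_congr_ae (ae_restrict_of_ae ?_)
  filter_upwards [ae_append_injective hd hx M] with y hy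
  rw [boltzmann_of_injective hφ β hy, pairWeight_append, ← mul_assoc, ← mul_assoc,
    mul_comm (∏ p ∈ D, _), Finset.prod_sdiff hD]
  rfl

/-- Both bounds come from one estimate with a free set `D` of pairs: `D = ∅` gives the first, the
pairs through a well-chosen index give the second. -/
theorem exists_correlation_bound (hd : 1 ≤ d) {φ : Space d → EReal} (hφ : IsPairPotential φ)
    (hRP : Repulsive φ) (hT : Tempered φ) (hBB : BddBelowBy φ) {β : ℝ} (hβ : 0 ≤ β) {ρ : ℝ≥0}
    (hρ : ρ ≠ 0) :
    ∃ ξ : ℝ≥0, ∀ Λ : Set (Space d), MeasurableSet Λ → volume Λ ≠ ⊤ → ∀ N n : ℕ,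
      (N : ℝ≥0∞) ≤ ρ * volume Λ → ∀ x : Fin n → Space d, (Function.Injective x ∨ φ 0 = ⊤) →
        correlation φ β Λ n N x ≤ (ξ : ℝ≥0∞) ^ n ∧
        (0 < n → correlation φ β Λ n N x ≤ repulsionFactor φ β x * (ξ : ℝ≥0∞) ^ n) := by
  -- At `β = 0` there is no repulsion to use, and by `0 * ⊤ = 0` coincident points keep weight `1`;
  -- the ideal gas is bounded directly.
  rcases hβ.eq_or_lt with rfl | hβ'
  · refine ⟨ρ, fun Λ _ _ N n hN x _ => ?_⟩
    rcases Nat.eq_zero_or_pos n with rfl | hn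
    · simp [correlation]
    rcases lt_or_ge N n with hnN | hnN
    · simp [correlation, hn.ne', hnN]
    have h := correlation_zero_beta_le (φ := φ) hn hnN hN x
    exact ⟨h, fun _ => by simpa [repulsionFactor] using h⟩
  · obtain ⟨A, R, lam, hR, hlam, hA⟩ := hT
    obtain ⟨C₀, hC₀, hup⟩ := exists_pairBoltzmann_le hφ hBB hβ hR
      ((Nat.cast_nonneg d).trans hlam.le) fun x hx => (hA x hx).1
    obtain ⟨ξ, hξ⟩ := exists_ruelle_bound hd (measurable_pairBoltzmann hφ.measurable β)
      (pairBoltzmann_ne_zero_ae hd φ β) hR hlam hC₀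
      (le_pairBoltzmann hφ hβ hR fun x hx => (hA x hx).2) hup
      (eventually_pairBoltzmann_le hφ hRP hβ') hρ
    refine ⟨ξ, fun Λ hΛ hΛf N n hN x hx => ?_⟩
    rcases Nat.eq_zero_or_pos n with rfl | hn
    · simp [correlation]
    rcases lt_or_ge N n with hnN | hnN
    · simp [correlation, hn.ne', hnN]
    by_cases hinj : Function.Injective x
    · have key : ∀ D : Finset (Fin n × Fin n), D ⊆ (Finset.univ.filter fun p => p.1 < p.2) →
          D.card ≤ n → correlation φ β Λ n N x ≤
            (∏ p ∈ D, pairBoltzmann φ β (x p.1 - x p.2)) * (ξ : ℝ≥0∞) ^ n := fun D hD hDn => by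
        rw [correlation_eq hn hnN, lintegral_boltzmann_append hd hφ β Λ hinj (N - n) hD,
          partitionFunction_eq hd hφ]
        refine ENNReal.div_le_of_le_mul ?_
        rw [mul_left_comm, mul_assoc]
        exact mul_le_mul_right (hξ Λ hΛ hΛf N n hn hnN hN x D hD hDn) _
      refine ⟨by simpa using key ∅ (by simp) (by simp), fun _ => ?_⟩
      obtain ⟨i, hi⟩ := exists_prod_pairsThrough_le hφ β hn hinj
      exact (key _ (Finset.filter_subset _ _) (card_pairsThrough_le i)).trans
        (mul_le_mul_left hi _)
    -- Coincident points in `x` have infinite energy, so the correlation function vanishes.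
    · have h0 : φ 0 = ⊤ := hx.resolve_left hinj
      have : correlation φ β Λ n N x = 0 := by
        rw [correlation_eq hn hnN, lintegral_congr fun y => boltzmann_of_not_injective hφ hβ' h0
          fun hxy => hinj (Fin.append_injective_iff.1 hxy).1]
        simp
      simp [this]

end Potential

/-! ### Bounded density along the volume sequence, and the theorem. -/

theorem IsVolumeSequence.eventually_le {d : ℕ} {Λ : ℕ → Set (Space d)} {ρ : ℝ}
    (hΛ : IsVolumeSequence Λ ρ) :
    ∃ N₁ : ℕ, ∀ N, N₁ ≤ N → (N : ℝ≥0∞) ≤ ((ρ + 1).toNNReal : ℝ≥0∞) * volume (Λ N) := by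
  obtain ⟨N₁, h⟩ := eventually_atTop.1 (hΛ.tendsto.eventually (gt_mem_nhds (lt_add_one ρ)))
  refine ⟨N₁, fun N hN => ?_⟩
  have hfin : volume (Λ N) ≠ ⊤ := (hΛ.bounded N).measure_lt_top.ne
  have hpos : 0 < (volume (Λ N)).toReal := ENNReal.toReal_pos (hΛ.pos N).ne' hfin
  have h1 : (N : ℝ) ≤ (ρ + 1) * (volume (Λ N)).toReal := ((div_lt_iff₀ hpos).1 (h N hN)).le
  rw [← ENNReal.ofReal_natCast]
  refine (ENNReal.ofReal_le_ofReal h1).trans (le_of_eq ?_)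
  rw [ENNReal.ofReal_mul (by linarith [hΛ.density_pos]), ENNReal.ofReal_toReal hfin]
  rfl

end CanonicalGibbs

end

theorem theorem3p2 (d : ℕ) (hd : 1 ≤ d) (φ : CanonicalGibbs.Space d → EReal)
    (hφ : CanonicalGibbs.IsPairPotential φ)
    (hRP : CanonicalGibbs.Repulsive φ)
    (hT : CanonicalGibbs.Tempered φ)
    (hBB : CanonicalGibbs.BddBelowBy φ)
    (β : ℝ) (hβ : 0 ≤ β)
    (Λ : ℕ → Set (CanonicalGibbs.Space d)) (ρ : ℝ)
    (hΛ : CanonicalGibbs.IsVolumeSequence Λ ρ) :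
    ∃ N₁ : ℕ, ∀ N₀ : ℕ, N₁ ≤ N₀ →
      (∃ ξ : ℝ≥0, ∀ N n : ℕ, N₀ ≤ N → ∀ x : Fin n → CanonicalGibbs.Space d,
        (∀ i, x i ∈ Λ N) → (Function.Injective x ∨ φ 0 = ⊤) →
          CanonicalGibbs.correlation φ β (Λ N) n N x ≤ (ξ : ℝ≥0∞) ^ n) ∧
      (∃ ζ : ℝ≥0, ∀ N n : ℕ, N₀ ≤ N → 2 ≤ n → ∀ x : Fin n → CanonicalGibbs.Space d,
        (∀ i, x i ∈ Λ N) → (Function.Injective x ∨ φ 0 = ⊤) →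
          CanonicalGibbs.correlation φ β (Λ N) n N x ≤
            EReal.exp (-(((2 / (n : ℝ) : ℝ) : EReal) *
              ∑ p : Fin n × Fin n with p.1 < p.2, (β : EReal) * φ (x p.1 - x p.2))) *
              (ζ : ℝ≥0∞) ^ n) := by
  obtain ⟨N₁, hN₁⟩ := hΛ.eventually_le
  have hρ : (ρ + 1).toNNReal ≠ 0 := (Real.toNNReal_pos.2 (by linarith [hΛ.density_pos])).ne'
  obtain ⟨ξ, hξ⟩ := CanonicalGibbs.exists_correlation_bound hd hφ hRP hT hBB hβ hρ
  have key := fun N (hN : N₁ ≤ N) => hξ (Λ N) (hΛ.measurable N) (hΛ.bounded N).measure_lt_top.ne N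
  exact ⟨N₁, fun N₀ hN₀ =>
    ⟨⟨ξ, fun N n hN x _ hx => (key N (hN₀.trans hN) n (hN₁ N (hN₀.trans hN)) x hx).1⟩,
      ⟨ξ, fun N n hN hn x _ hx =>
        (key N (hN₀.trans hN) n (hN₁ N (hN₀.trans hN)) x hx).2 (by omega)⟩⟩⟩
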